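/- Let $(X_k)_{k\ge1}$ be independent real random variables with $\mathbb E[X_k]=0$ and $\mathrm{Var}(X_k)=1$, such that the law of each $X_k$ has a density $p_k$ that vanishes outside some interval and is positive and differentiable in the interior of that interval. Let $\tau_k(x)=\frac{1}{p_k(x)}\int_x^\infty y\,p_k(y)\,dy$ be the Stein kernel of $X_k$. For an $n\times n$ real symmetric matrix $A=(a_{uv})$ with zero diagonal put $$F_n=\sum_{1\le u\le v\le n}a_{uv}X_uX_v,\qquad \sigma_n^2=\mathrm{Var}(F_n),\qquad \mathcal M_kF_n=\tfrac12X_k\sum_{v=1}^n a_{kv}X_v,\qquad \Theta_{F_n}=\sum_{k=1}^n\partial_kF_n\;\mathcal L_k\mathcal M_kF_n,$$ where, for a function $G$ of $x=(x_1,\dots,x_n)$, $\mathcal L_kG(x)=\frac1{p_k(x_k)}\int_{x_k}^\infty\big(G(x,x_k=y)-\mathbb E_k[G](x)\big)p_k(y)\,dy$, $\mathbb E_k[G](x)=\int_{\mathbb R} G(x,x_k=z)p_k(z)\,dz$, $G(x,x_k=y)$ is the value of $G$ after replacing the $k$-th coordinate of $x$ by $y$, and $\Theta_{F_n}$ is evaluated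 at $(X_1,\dots,X_n)$; thus $\Theta_{F_n}=\frac12\sum_{u=1}^n\big(\sum_{v=1}^na_{uv}X_v\big)^2\tau_u(X_u)$ almost surely. For a random variable $F$ with mean $\mu$ and variance $s^2>0$ whose law has an absolutely continuous density $p_F$, with Radon–Nikodym derivative $p_F'$ and score $\rho_F=p_F'/p_F$, the Fisher information distance to $N(\mu,s^2)$ is $\mathbb E\big[(\rho_F(F)+\frac{F-\mu}{s^2})^2\big]$; it is $+\infty$ if there is no such density. For $F$ of mean $0$ and variance $1$ it is denoted $I(F\|Z)$, where $Z\sim N(0,1)$. Theorem. For every $\beta\in[0,\infty)$ there is a constant $C_\beta>0$ depending only on $\beta$ such that the following holds. For all $(X_k)_{k\ge1}$ as above with $$\max\Big\{\sup_{k\ge1}\mathbb E|X_k|^8,\ \sup_{k\ge1}\mathbb E|\tau_k(X_k)|^8,\ \sup_{k\ge1}\mathbb E|\tau_k'(X_k)|^8\Big\}=\beta,$$ all $n\ge1$ and all $A$ as above with $\sigma_n>0$, $$I(\sigma_n^{-1}F_n\|Z)\le\frac{C_\beta}{\sigma_n^4}\left(\sum_{k=1}^n\Big(\sum_{v=1}^na_{kv}^2\Big)^2+\sum_{u,v=1}^n\Big(\sum_{k=1}^na_{ku}a_{kv}\Big)^2\right)\big\|\sigma_n^2\Theta_{F_n}^{-1}\big\|_8^3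 .$$ Here $\|Y\|_8=(\mathbb E|Y|^8)^{1/8}\in[0,\infty]$ and $\Theta_{F_n}^{-1}=+\infty$ where $\Theta_{F_n}=0$; in particular, if the right side is finite, then the law of $\sigma_n^{-1}F_n$ has an absolutely continuous density. -/

import Mathlib

open MeasureTheory ProbabilityTheory Set
open scoped ENNReal NNReal

namespace QuadFisher

noncomputable section

/-- `p` is a density of the probability law `ν` which vanishes outside an interval `I` and is
positive and differentiable in the interior of `I` (the endpoints, if any, play no role). -/
structure IsDiffDensity (ν : Measure ℝ) (p : ℝ → ℝ) : Prop where
  law : ν = volume.withDensity (fun x => ENNReal.ofReal (p x))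
  nonneg : ∀ x, 0 ≤ p x
  supp : ∃ I : Set ℝ, I.OrdConnected ∧ (∀ x, x ∉ I → p x = 0) ∧
    ∀ x ∈ interior I, 0 < p x ∧ DifferentiableAt ℝ p x

/-- The Stein kernel `τ(x) = (∫_x^∞ (y - m) p(y) dy) / p(x)`, `m = ∫ z p(z) dz`, of a law with
density `p`. -/
def steinKernel (p : ℝ → ℝ) (x : ℝ) : ℝ :=
  (∫ y in Ioi x, (y - ∫ z, z * p z) * p y) / p x

/-- `β = max {sup_k E|X_k|^8, sup_k E|τ_k(X_k)|^8, sup_k E|τ_k'(X_k)|^8}`, where `p k` is the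
density of `X k`. -/
def momentBound {Ω : Type*} [MeasurableSpace Ω] (P : Measure Ω) (X : ℕ → Ω → ℝ)
    (p : ℕ → ℝ → ℝ) : ℝ≥0∞ :=
  max (⨆ k, ∫⁻ ω, ‖X k ω‖ₑ ^ 8 ∂P)
    (max (⨆ k, ∫⁻ ω, ‖steinKernel (p k) (X k ω)‖ₑ ^ 8 ∂P)
      (⨆ k, ∫⁻ ω, ‖deriv (steinKernel (p k)) (X k ω)‖ₑ ^ 8 ∂P))

/-- The generalized Stein kernel
`(L_k G)(x) = (∫_{x_k}^∞ (G(x, x_k = y) - E_k[G](x)) p_k(y) dy) / p_k(x_k)`, where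
`E_k[G](x) = ∫ G(x, x_k = z) p_k(z) dz` is the expectation in the `k`-th variable. -/
def steinOp {n : ℕ} (p : Fin n → ℝ → ℝ) (k : Fin n) (G : (Fin n → ℝ) → ℝ)
    (x : Fin n → ℝ) : ℝ :=
  (∫ y in Ioi (x k), (G (Function.update x k y) -
    ∫ z, G (Function.update x k z) * p k z) * p k y) / p k (x k)

/-- `Θ_F = ∑_k ∂_k F · L_k (M_k F)` for a statistic `F` and a decomposition `M` of it. -/
def theta {n : ℕ} (p : Fin n → ℝ → ℝ) (F : (Fin n → ℝ) → ℝ) (M : Fin n → (Fin n → ℝ) → ℝ)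
    (x : Fin n → ℝ) : ℝ :=
  ∑ k, deriv (fun y => F (Function.update x k y)) (x k) * steinOp p k (M k) x

/-- The quadratic form `∑_{u ≤ v} a_{uv} x_u x_v`. -/
def quadForm {n : ℕ} (A : Matrix (Fin n) (Fin n) ℝ) (x : Fin n → ℝ) : ℝ :=
  ∑ u, ∑ v ∈ Finset.univ.filter (fun v => u ≤ v), A u v * x u * x v

/-- The decomposition `M_k = (1/2) x_k ∑_v a_{kv} x_v` of the quadratic form. -/
def quadDecomp {n : ℕ} (A : Matrix (Fin n) (Fin n) ℝ) (k : Fin n) (x : Fin n → ℝ) : ℝ :=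
  1 / 2 * x k * ∑ v, A k v * x v

/-- `p` is an absolutely continuous density of `ν` with Radon–Nikodym derivative `dp`. -/
structure IsACDensity (ν : Measure ℝ) (p dp : ℝ → ℝ) : Prop where
  law : ν = volume.withDensity (fun x => ENNReal.ofReal (p x))
  nonneg : ∀ x, 0 ≤ p x
  locallyIntegrable : LocallyIntegrable dp volume
  integral_eq : ∀ a b, p b - p a = ∫ x in a..b, dp x

/-- The Fisher information distance `E[(ρ(F) + (F - m) / s²)²]`, `ρ = p' / p`, of a law `ν` with
mean `m` and variance `s²` to the normal law `N(m, s²)`. An absolutely continuous density `p` of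
`ν` is unique and `p'` is unique almost everywhere, so the infimum is over equal values;
it is `∞` when there is no such density. -/
def fisherDistance (ν : Measure ℝ) : ℝ≥0∞ :=
  ⨅ (p : ℝ → ℝ) (dp : ℝ → ℝ) (_ : IsACDensity ν p dp),
    ∫⁻ x, ENNReal.ofReal ((dp x / p x + (x - ∫ y, y ∂ν) / variance id ν) ^ 2) ∂ν

end

end QuadFisher

namespace QuadFisher

open Filter Topology

set_option linter.unusedSectionVars false
set_option linter.unusedVariables false

/-! ### One-dimensional Stein kernels -/

/-! Write `Y_k = ∑_v a_{kv} x_v = ∂_k F`, so that `Θ = ½ ∑_k τ_k Y_k²`, and put `G = ½ ∑_k τ_k Y_k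
∂_kΘ`. By homogeneity in the matrix one may take `σ = 1`, and then `E Θ = E F² = 1`.

Score. In one variable, integration by parts gives the Stein identity `E[τ(X) h'(X)] = E[X h(X)]`
(`IsDiffDensity.exists_isSteinKernel`). It is applied in coordinate `k` to `φ(F) Y_k / (Θ + ε)`,
where the zero diagonal makes `Y_k` independent of `x_k`. Summing over `k` with weight `½` and
letting `ε → 0` yields `E[φ'(F)] = E[φ(F) S]` with `S = F/Θ + G/Θ²`
(`integral_deriv_comp_quadPart`). Consequently the law of `F` has the absolutely continuous density
`x ↦ E[S 1_{F ≥ x}]`, its score is `-E[S | F]`, and since conditional expectation contracts `L²` the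
Fisher distance is at most `E[(F - S)²]` (`fisherDistance_map_le`).

Hölder. One has `F - S = F Θ⁻¹ (Θ - 1) - G/Θ²`. The square of the first term costs `‖F‖₈² ‖Θ⁻¹‖₈² ‖Θ
- 1‖₄²`. For the second, Cauchy–Schwarz with weights `τ_k` gives `(G/Θ²)² ≤ ½ ∑_k τ_k Θ⁻³ (∂_kΘ)²`,
whose expectation is controlled by `‖τ_k‖₈ ‖Θ⁻¹‖₈³ ‖∂_kΘ‖₄²`; this is the source of the third power.
The square in the first term is absorbed because `‖Θ⁻¹‖₈ ≥ 1`.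

Moments. It remains to bound `‖Θ - 1‖₄²` and `∑_k ‖∂_kΘ‖₄²` by the matrix functional `fourthSum`.
Each polynomial statistic is averaged over the coordinates outside a set `S`, and coordinates are
revealed one at a time. Every increment is centered given the other coordinates, so two-smoothness
of `L⁴` and `L⁸`, in the form `‖f + D‖² ≤ ‖f‖² + 40 ‖D‖²`, bounds the squared norm by the sum of the
squared norms of the increments (`IsTelescope.lpLe`). Increments are products of a function of `x_k`
and a statistic of lower degree free of `x_k`, so their norms factor and the bounds follow by
climbing in degree: `linPart`, `kerSum`, then `biPart`, `quadPart`, `sqPart`, then `thetaPart` and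
`gradTheta`. -/

theorem countable_frontier_of_ordConnected {I : Set ℝ} (hI : I.OrdConnected) :
    (frontier I).Countable := by
  have hsub : frontier I ⊆ {x | IsLUB I x} ∪ {x | IsGLB I x} := by
    intro x hx
    have hxc : x ∈ closure I := frontier_subset_closure hx
    have hxi : x ∉ interior I := fun h => hx.2 h
    by_cases hup : x ∈ upperBounds I
    · left
      exact isLUB_of_mem_closure hup hxc
    · right
      refine isGLB_of_mem_closure ?_ hxc
      by_contra hlow
      simp only [mem_upperBounds, mem_lowerBounds, not_forall, not_le] at hup hlow
      obtain ⟨b, hb, hxb⟩ := hup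
      obtain ⟨a, ha, hax⟩ := hlow
      apply hxi
      refine mem_interior.2 ⟨Ioo a b, ?_, isOpen_Ioo, ⟨hax, hxb⟩⟩
      exact Ioo_subset_Icc_self.trans (hI.out ha hb)
  refine Set.Countable.mono hsub (Set.Countable.union ?_ ?_)
  · exact Set.Subsingleton.countable fun a ha b hb => IsLUB.unique ha hb
  · exact Set.Subsingleton.countable fun a ha b hb => IsGLB.unique ha hb

/-- `t` is a nonnegative version of the Stein kernel of the centered law `ν`, differentiable on an
open set `U` of full measure with derivative `dt`. -/
structure IsSteinKernel (ν : Measure ℝ) (U : Set ℝ) (t dt : ℝ → ℝ) : Prop where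
  measurable : Measurable t
  measurable_deriv : Measurable dt
  nonneg : ∀ x, 0 ≤ t x
  isOpen : IsOpen U
  ae_mem : ∀ᵐ x ∂ν, x ∈ U
  hasDerivAt : ∀ x ∈ U, HasDerivAt t (dt x) x
  integral_mul_deriv : ∀ h h' : ℝ → ℝ, Measurable h → (∀ x ∈ U, HasDerivAt h (h' x) x) →
    (∃ M, ∀ x, |h x| ≤ M) → Integrable (fun x => t x * h' x) ν →
    ∫ x, t x * h' x ∂ν = ∫ x, x * h x ∂ν

theorem tendsto_integral_Ioi_zero {f : ℝ → ℝ} (hf : Integrable f) (h0 : ∫ x, f x = 0) :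
    Tendsto (fun x => ∫ y in Ioi x, f y) atTop (𝓝 0) ∧
      Tendsto (fun x => ∫ y in Ioi x, f y) atBot (𝓝 0) := by
  have key : ∀ x, ∫ y in Ioi x, f y = (∫ y in Ioi 0, f y) - ∫ y in (0 : ℝ)..x, f y := by
    intro x
    rw [← intervalIntegral.integral_Ioi_sub_Ioi' hf.integrableOn hf.integrableOn]
    ring
  constructor
  · have h1 := intervalIntegral_tendsto_integral_Ioi (f := f) 0 hf.integrableOn tendsto_id
    have := (tendsto_const_nhds (x := ∫ y in Ioi 0, f y)).sub h1
    rw [sub_self] at this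
    exact this.congr fun x => (key x).symm
  · have h1 := intervalIntegral_tendsto_integral_Iic (f := f) 0 hf.integrableOn tendsto_id
    have h2 : (∫ y in Iic 0, f y) + ∫ y in Ioi 0, f y = 0 := by
      have := integral_add_compl (s := Iic (0 : ℝ)) measurableSet_Iic hf
      rwa [compl_Iic, h0] at this
    have := (tendsto_const_nhds (x := ∫ y in Ioi 0, f y)).add h1
    rw [add_comm, h2] at this
    refine this.congr fun x => ?_
    rw [key x, intervalIntegral.integral_symm]
    simp only [id, sub_eq_add_neg]

theorem continuous_integral_Ioi_of_integrable {f : ℝ → ℝ} (hf : Integrable f) :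
    Continuous fun x => ∫ y in Ioi x, f y := by
  have key : (fun x => ∫ y in Ioi x, f y) =
      fun x => (∫ y in Ioi 0, f y) - ∫ y in (0 : ℝ)..x, f y := by
    funext x
    rw [← intervalIntegral.integral_Ioi_sub_Ioi' hf.integrableOn hf.integrableOn]
    ring
  rw [key]
  exact continuous_const.sub
    (intervalIntegral.continuous_primitive (fun a b => hf.intervalIntegrable) 0)

theorem hasDerivAt_integral_Ioi_of_integrable {f : ℝ → ℝ} (hf : Integrable f) {x : ℝ}
    (hx : ContinuousAt f x) :
    HasDerivAt (fun x => ∫ y in Ioi x, f y) (-f x) x := by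
  have key : (fun x => ∫ y in Ioi x, f y) =
      fun x => (∫ y in Ioi 0, f y) - ∫ y in (0 : ℝ)..x, f y := by
    funext x
    rw [← intervalIntegral.integral_Ioi_sub_Ioi' hf.integrableOn hf.integrableOn]
    ring
  rw [key]
  have := intervalIntegral.integral_hasDerivAt_right (a := 0) (b := x) hf.intervalIntegrable
    (hf.aestronglyMeasurable.stronglyMeasurableAtFilter) hx
  exact this.const_sub _

/-- A countable exceptional set is allowed because the function used later may fail to be
differentiable at the endpoints of the support. -/
theorem integral_eq_zero_of_hasDerivAt_of_tendsto {G G' : ℝ → ℝ} {s : Set ℝ} (hs : s.Countable)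
    (hG : Continuous G) (hd : ∀ x, x ∉ s → HasDerivAt G (G' x) x) (hi : Integrable G')
    (ht : Tendsto G atTop (𝓝 0)) (hb : Tendsto G atBot (𝓝 0)) : ∫ x, G' x = 0 := by
  have h1 := intervalIntegral_tendsto_integral hi
    (tendsto_neg_atTop_atBot.comp tendsto_natCast_atTop_atTop)
    (tendsto_natCast_atTop_atTop (R := ℝ))
  have h2 : ∀ n : ℕ, ∫ x in ((Neg.neg ∘ Nat.cast) n : ℝ)..(n : ℝ), G' x = G n - G (-n) := by
    intro n
    exact MeasureTheory.integral_eq_of_hasDerivAt_off_countable G G' hs hG.continuousOn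
      (fun x hx => hd x hx.2) hi.intervalIntegrable
  simp only [h2] at h1
  have h3 : Tendsto (fun n : ℕ => G n - G (-n)) atTop (𝓝 (0 - 0)) :=
    (ht.comp tendsto_natCast_atTop_atTop).sub
      (hb.comp (tendsto_neg_atTop_atBot.comp tendsto_natCast_atTop_atTop))
  rw [sub_zero] at h3
  exact tendsto_nhds_unique h1 h3

/-- With `g(x) = ∫_x^∞ y p(y) dy` one has `g' = -x p` and `τ = g/p` on the interior `U` of the
support, so `(g h)' = p (τ h' - x h)` there. The Stein identity says that this derivative has
integral zero: `g` tends to `0` at both infinities because the mean is zero, and it vanishes off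
`U`. The kernel is cut off outside `U` to obtain a measurable, nonnegative version. -/
theorem IsDiffDensity.exists_isSteinKernel {ν : Measure ℝ} [IsProbabilityMeasure ν] {p : ℝ → ℝ}
    (hp : IsDiffDensity ν p) (hid : Integrable (fun x => x) ν) (hmean : ∫ x, x ∂ν = 0) :
    ∃ (U : Set ℝ) (t : ℝ → ℝ), IsSteinKernel ν U t (deriv (steinKernel p)) ∧
      ∀ x ∈ U, t x = steinKernel p x := by
  obtain ⟨I, hI, hoff, hon⟩ := hp.supp
  set U := interior I with hU
  have hUo : IsOpen U := isOpen_interior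
  have hUc : U.OrdConnected := hI.interior
  have hcount : (frontier I).Countable := countable_frontier_of_ordConnected hI
  have hpU : ∀ᵐ x : ℝ, x ∉ U → p x = 0 := by
    have h0 : (volume : Measure ℝ) (frontier I) = 0 := hcount.measure_zero _
    filter_upwards [compl_mem_ae_iff.2 h0] with x hx hxU
    apply hoff
    intro hxI
    exact hx ⟨subset_closure hxI, hxU⟩
  have hpcont : ContinuousOn p U := fun x hx =>
    (hon x hx).2.continuousAt.continuousWithinAt
  -- Measurability of `p` is not assumed: it comes from continuity on `U` and vanishing almost
  -- everywhere off `U`.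
  have hpae : AEMeasurable p := by
    have h1 : AEMeasurable (U.indicator p) := by
      rw [aemeasurable_indicator_iff hUo.measurableSet]
      exact hpcont.aemeasurable hUo.measurableSet
    refine h1.congr ?_
    filter_upwards [hpU] with x hx
    by_cases hxU : x ∈ U
    · simp [hxU]
    · simp [hxU, hx hxU]
  have hpae' : AEMeasurable (fun x => ENNReal.ofReal (p x)) := hpae.ennreal_ofReal
  have hlt : ∀ᵐ x : ℝ, ENNReal.ofReal (p x) < ∞ := ae_of_all _ fun x => ENNReal.ofReal_lt_top
  have hint : ∀ f : ℝ → ℝ, Integrable f ν ↔ Integrable fun x => p x * f x := by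
    intro f
    rw [hp.law, integrable_withDensity_iff_integrable_smul₀' hpae' hlt]
    simp [ENNReal.toReal_ofReal (hp.nonneg _)]
  have hintegral : ∀ f : ℝ → ℝ, ∫ x, f x ∂ν = ∫ x, p x * f x := by
    intro f
    rw [hp.law, integral_withDensity_eq_integral_toReal_smul₀ hpae' hlt]
    simp [ENNReal.toReal_ofReal (hp.nonneg _)]
  have hyp : Integrable fun y => y * p y := by
    simpa [mul_comm] using (hint _).1 hid
  have hyp0 : ∫ y, y * p y = 0 := by
    rw [← hmean, hintegral]
    simp [mul_comm]
  set g : ℝ → ℝ := fun x => ∫ y in Ioi x, y * p y with hg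
  have hst : ∀ x, steinKernel p x = g x / p x := by
    intro x
    simp [steinKernel, hyp0, hg]
  have hgc : Continuous g := continuous_integral_Ioi_of_integrable hyp
  have hgd : ∀ x ∈ U, HasDerivAt g (-(x * p x)) x := fun x hx =>
    hasDerivAt_integral_Ioi_of_integrable hyp
      (continuousAt_id.mul (hon x hx).2.continuousAt)
  -- For negative `x` the mean-zero condition rewrites the upper tail as minus the lower tail, whose
  -- integrand is nonpositive.
  have hg0 : ∀ x, 0 ≤ g x := by
    intro x
    rcases le_or_gt 0 x with hx | hx
    · refine setIntegral_nonneg measurableSet_Ioi fun y hy => ?_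
      exact mul_nonneg (hx.trans (le_of_lt hy)) (hp.nonneg y)
    · have h2 := integral_add_compl (s := Iic x) measurableSet_Iic hyp
      rw [compl_Iic, hyp0] at h2
      have h3 : ∫ y in Iic x, y * p y ≤ 0 := by
        refine setIntegral_nonpos measurableSet_Iic fun y hy => ?_
        exact mul_nonpos_of_nonpos_of_nonneg (le_trans hy hx.le) (hp.nonneg y)
      simp only [hg]
      linarith
  -- By convexity of `U`, a point off `U` has all the mass on one side; the tail integral is then
  -- either empty or the full mean.
  have hgoff : ∀ x, x ∉ U → g x = 0 := by
    intro x hx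
    by_cases hup : ∃ u ∈ U, x < u
    · obtain ⟨u, hu, hxu⟩ := hup
      have hlow : ∀ v ∈ U, x < v := by
        intro v hv
        by_contra hvx
        exact hx (hUc.out hv hu ⟨not_lt.1 hvx, hxu.le⟩)
      have h2 := integral_add_compl (s := Iic x) measurableSet_Iic hyp
      rw [compl_Iic, hyp0] at h2
      have h3 : ∫ y in Iic x, y * p y = 0 := by
        refine setIntegral_eq_zero_of_ae_eq_zero ?_
        filter_upwards [hpU] with y hy hyx
        rw [hy fun h => absurd (hlow y h) (not_lt.2 hyx), mul_zero]
      simp only [hg]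
      linarith
    · push Not at hup
      refine setIntegral_eq_zero_of_ae_eq_zero ?_
      filter_upwards [hpU] with y hy hyx
      rw [hy fun h => absurd (hup y h) (not_le.2 hyx), mul_zero]
  have hgtop := (tendsto_integral_Ioi_zero hyp hyp0).1
  have hgbot := (tendsto_integral_Ioi_zero hyp hyp0).2
  have hnull : ∀ᵐ x ∂ν, x ∈ U := by
    rw [hp.law]
    refine (ae_withDensity_iff' hpae').2 ?_
    filter_upwards [hpU] with x hx hne
    by_contra hxU
    simp [hx hxU] at hne
  have hstd : ∀ x ∈ U, DifferentiableAt ℝ (steinKernel p) x := by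
    intro x hx
    have : steinKernel p = fun x => g x / p x := funext hst
    rw [this]
    exact (hgd x hx).differentiableAt.div (hon x hx).2 (hon x hx).1.ne'
  refine ⟨U, U.indicator (steinKernel p), ⟨?_, measurable_deriv _, ?_, hUo, hnull, ?_, ?_⟩, ?_⟩
  · classical
    have : U.indicator (steinKernel p) = U.piecewise (steinKernel p) 0 := by
      rw [piecewise_eq_indicator]
    rw [this]
    exact ContinuousOn.measurable_piecewise
      (fun x hx => (hstd x hx).continuousAt.continuousWithinAt) continuousOn_const
      hUo.measurableSet
  · intro x
    refine indicator_nonneg (fun x _ => ?_) x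
    rw [hst]
    exact div_nonneg (hg0 x) (hp.nonneg x)
  · intro x hx
    refine (hstd x hx).hasDerivAt.congr_of_eventuallyEq ?_
    filter_upwards [hUo.mem_nhds hx] with y hy
    simp [hy]
  · intro h h' hh hd ⟨M, hM⟩ hi
    have hixh : Integrable (fun x => x * h x) ν :=
      hid.mul_bdd (c := M) hh.aestronglyMeasurable (ae_of_all _ hM)
    set G : ℝ → ℝ := fun x => g x * U.indicator h x with hG
    set G' : ℝ → ℝ := U.indicator (fun x => -(x * p x) * h x + g x * h' x) with hG'
    have hG'eq : G' =ᵐ[volume]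
        fun x => p x * (U.indicator (steinKernel p) x * h' x - x * h x) := by
      filter_upwards [hpU] with x hx
      by_cases hxU : x ∈ U
      · have := (hon x hxU).1.ne'
        simp only [hG', hxU, indicator_of_mem, hst]
        field_simp
        ring
      · simp [hG', hxU, hx hxU]
    have hGbound : ∀ x, |G x| ≤ |M| * g x := by
      intro x
      rw [hG, abs_mul, abs_of_nonneg (hg0 x), mul_comm]
      refine mul_le_mul_of_nonneg_right ?_ (hg0 x)
      by_cases hxU : x ∈ U
      · simpa [hxU] using (hM x).trans (le_abs_self M)
      · simp [hxU]
    have hGd : ∀ x ∈ U, HasDerivAt G (G' x) x := by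
      intro x hx
      have h1 := (hgd x hx).mul (hd x hx)
      refine (h1.congr_of_eventuallyEq ?_).congr_deriv ?_
      · filter_upwards [hUo.mem_nhds hx] with y hy
        simp [hG, hy]
      · simp [hG', hx]
    have hlim : ∀ {l : Filter ℝ}, Tendsto g l (𝓝 0) → Tendsto G l (𝓝 0) := by
      intro l hl
      refine squeeze_zero_norm (fun x => hGbound x) ?_
      simpa using hl.const_mul |M|
    have hzero : ∫ x, G' x = 0 := by
      refine integral_eq_zero_of_hasDerivAt_of_tendsto (hcount) (G := G) ?_ ?_ ?_
        (hlim hgtop) (hlim hgbot)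
      -- `h` may jump at the boundary of `U`, but it is bounded and `g` tends to zero there, so `G`
      -- stays continuous.
      · rw [continuous_iff_continuousAt]
        intro x
        by_cases hx : x ∈ U
        · exact (hGd x hx).continuousAt
        · have h1 : Tendsto g (𝓝 x) (𝓝 0) := by
            simpa [hgoff x hx] using hgc.tendsto x
          have h2 : G x = 0 := by simp [hG, hx]
          rw [ContinuousAt, h2]
          exact hlim h1
      · intro x hx
        by_cases hxU : x ∈ U
        · exact hGd x hxU
        · have hxc : x ∉ closure U := by
            intro hxc
            exact hx ⟨closure_mono interior_subset hxc, hxU⟩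
          have h1 : G' x = 0 := by simp [hG', hxU]
          rw [h1]
          refine (hasDerivAt_const x (0 : ℝ)).congr_of_eventuallyEq ?_
          filter_upwards [isClosed_closure.isOpen_compl.mem_nhds hxc] with y hy
          have : y ∉ U := fun h => hy (subset_closure h)
          simp [hG, this]
      · rw [integrable_congr hG'eq, ← hint]
        exact hi.sub hixh
    rw [integral_congr_ae hG'eq, ← hintegral, integral_sub hi hixh] at hzero
    linarith
  · intro x hx
    simp [hx]

/-! ### Resampling one coordinate of a product measure -/

section Resample

variable {ι : Type*} [Fintype ι] [DecidableEq ι] {ν : ι → Measure ℝ}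
  [∀ i, IsProbabilityMeasure (ν i)]

theorem measurable_update_prod (k : ι) :
    Measurable fun z : (ι → ℝ) × ℝ => Function.update z.1 k z.2 := by
  refine measurable_pi_lambda _ fun i => ?_
  by_cases h : i = k
  · subst h
    simpa using measurable_snd
  · simp only [Function.update_of_ne h]
    exact (measurable_pi_apply i).comp measurable_fst

/-- Replacing one coordinate by an independent copy preserves a product law. This gives Fubini in a
single coordinate without splitting the index type. -/
theorem measurePreserving_update (k : ι) :
    MeasurePreserving (fun z : (ι → ℝ) × ℝ => Function.update z.1 k z.2)
      ((Measure.pi ν).prod (ν k)) (Measure.pi ν) := by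
  refine ⟨measurable_update_prod k, ?_⟩
  symm
  refine Measure.pi_eq fun s hs => ?_
  rw [Measure.map_apply (measurable_update_prod k) (MeasurableSet.univ_pi hs)]
  have hpre : (fun z : (ι → ℝ) × ℝ => Function.update z.1 k z.2) ⁻¹' (univ.pi s) =
      (univ.pi (Function.update s k univ)) ×ˢ (s k) := by
    ext z
    simp only [mem_preimage, mem_univ_pi, mem_prod]
    constructor
    · intro h
      refine ⟨fun i => ?_, by simpa using h k⟩
      by_cases hi : i = k
      · subst hi; simp
      · simpa [Function.update_of_ne hi] using h i
    · rintro ⟨h1, h2⟩ i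
      by_cases hi : i = k
      · subst hi; simpa using h2
      · simpa [Function.update_of_ne hi] using h1 i
  rw [hpre, Measure.prod_prod, Measure.pi_pi, ← Finset.mul_prod_erase _ _ (Finset.mem_univ k),
    ← Finset.mul_prod_erase _ (fun i => ν i (s i)) (Finset.mem_univ k)]
  simp only [Function.update_self, measure_univ, one_mul]
  rw [mul_comm]
  congr 1
  refine Finset.prod_congr rfl fun i hi => ?_
  rw [Function.update_of_ne (Finset.ne_of_mem_erase hi)]

theorem integral_update {f : (ι → ℝ) → ℝ} (hf : Integrable f (Measure.pi ν)) (k : ι) :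
    ∫ x, ∫ y, f (Function.update x k y) ∂(ν k) ∂(Measure.pi ν) = ∫ x, f x ∂(Measure.pi ν) := by
  have hmp := measurePreserving_update (ν := ν) k
  have h1 : Integrable (fun z : (ι → ℝ) × ℝ => f (Function.update z.1 k z.2))
      ((Measure.pi ν).prod (ν k)) := hmp.integrable_comp_of_integrable hf
  rw [← integral_prod _ h1]
  have h2 := integral_map (μ := (Measure.pi ν).prod (ν k)) hmp.measurable.aemeasurable (f := f)
    (by rw [hmp.map_eq]; exact hf.aestronglyMeasurable)
  rw [← h2, hmp.map_eq]

theorem ae_integrable_update {f : (ι → ℝ) → ℝ} (hf : Integrable f (Measure.pi ν)) (k : ι) :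
    ∀ᵐ x ∂(Measure.pi ν), Integrable (fun y => f (Function.update x k y)) (ν k) :=
  ((measurePreserving_update (ν := ν) k).integrable_comp_of_integrable hf).prod_right_ae

theorem lintegral_update {f : (ι → ℝ) → ℝ≥0∞} (hf : Measurable f) (k : ι) :
    ∫⁻ x, ∫⁻ y, f (Function.update x k y) ∂(ν k) ∂(Measure.pi ν) = ∫⁻ x, f x ∂(Measure.pi ν) := by
  have hmp := measurePreserving_update (ν := ν) k
  rw [← hmp.lintegral_comp hf]
  exact (lintegral_prod _ (hf.comp hmp.measurable).aemeasurable).symm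

/-- `g` does not depend on the `k`-th coordinate. -/
def FreeOf (k : ι) (g : (ι → ℝ) → ℝ) : Prop := ∀ x y, g (Function.update x k y) = g x

variable (ν) in
/-- The conditional expectation of `D` given all coordinates but the `k`-th vanishes. -/
def Centered (k : ι) (D : (ι → ℝ) → ℝ) : Prop :=
  ∀ x, Integrable (fun y => D (Function.update x k y)) (ν k) ∧
    ∫ y, D (Function.update x k y) ∂(ν k) = 0

theorem Centered.add {k : ι} {D E : (ι → ℝ) → ℝ} (hD : Centered ν k D) (hE : Centered ν k E) :
    Centered ν k (fun x => D x + E x) := fun x =>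
  ⟨(hD x).1.add (hE x).1, by rw [integral_add (hD x).1 (hE x).1, (hD x).2, (hE x).2, add_zero]⟩

theorem FreeOf.centered_mul {k : ι} {g : (ι → ℝ) → ℝ} (hg : FreeOf k g) {η : ℝ → ℝ}
    (hη : Integrable η (ν k)) (h0 : ∫ y, η y ∂(ν k) = 0) :
    Centered ν k (fun x => η (x k) * g x) := fun x => by
  simp only [Function.update_self, hg x]
  exact ⟨hη.mul_const _, by rw [integral_mul_const, h0, zero_mul]⟩

/-- Orthogonality of a centered increment to everything that ignores coordinate `k`: integrate over
that coordinate before the others. -/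
theorem Centered.integral_mul_eq_zero {k : ι} {g D : (ι → ℝ) → ℝ} (hD : Centered ν k D)
    (hg : FreeOf k g) (hi : Integrable (fun x => g x * D x) (Measure.pi ν)) :
    ∫ x, g x * D x ∂(Measure.pi ν) = 0 := by
  rw [← integral_update hi k]
  simp [hg _ _, integral_const_mul, (hD _).2]

theorem Centered.integral_eq_zero {k : ι} {D : (ι → ℝ) → ℝ} (hD : Centered ν k D)
    (hi : Integrable D (Measure.pi ν)) : ∫ x, D x ∂(Measure.pi ν) = 0 := by
  rw [← integral_update hi k]
  simp [(hD _).2]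

theorem FreeOf.lintegral_mul {k : ι} {g : (ι → ℝ) → ℝ} (hg : FreeOf k g) (hgm : Measurable g)
    {η : ℝ → ℝ} (hη : Measurable η) (p : ℝ) (hp : 0 ≤ p) :
    ∫⁻ x, ‖η (x k) * g x‖ₑ ^ p ∂(Measure.pi ν) =
      (∫⁻ y, ‖η y‖ₑ ^ p ∂(ν k)) * ∫⁻ x, ‖g x‖ₑ ^ p ∂(Measure.pi ν) := by
  rw [← lintegral_update (ν := ν) (f := fun x => ‖η (x k) * g x‖ₑ ^ p) (by fun_prop) k]
  simp only [Function.update_self, hg _ _, enorm_mul, ENNReal.mul_rpow_of_nonneg _ _ hp]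
  have : ∀ x, ∫⁻ y, ‖η y‖ₑ ^ p * ‖g x‖ₑ ^ p ∂(ν k) =
      (∫⁻ y, ‖η y‖ₑ ^ p ∂(ν k)) * ‖g x‖ₑ ^ p := fun x =>
    lintegral_mul_const _ (by fun_prop)
  simp only [this]
  rw [lintegral_const_mul _ (by fun_prop)]

end Resample

/-! ### Bounds on `L^p` norms -/

section LpLe

variable {α : Type*} [MeasurableSpace α] {μ : Measure α}

/-- `f` is measurable and `‖f‖_p ≤ B`. -/
structure LpLe (μ : Measure α) (p : ℝ≥0∞) (f : α → ℝ) (B : ℝ) : Prop where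
  measurable : Measurable f
  nonneg : 0 ≤ B
  le : eLpNorm f p μ ≤ ENNReal.ofReal B

namespace LpLe

variable {p : ℝ≥0∞} {f g : α → ℝ} {B C : ℝ}

theorem memLp (h : LpLe μ p f B) : MemLp f p μ :=
  ⟨h.measurable.aestronglyMeasurable, h.le.trans_lt ENNReal.ofReal_lt_top⟩

theorem mono (h : LpLe μ p f B) (hBC : B ≤ C) : LpLe μ p f C :=
  ⟨h.measurable, h.nonneg.trans hBC, h.le.trans (ENNReal.ofReal_le_ofReal hBC)⟩

theorem of_eq (h : LpLe μ p f B) (hfg : ∀ x, f x = g x) : LpLe μ p g B := by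
  rwa [← funext hfg]

theorem exponent_mono [IsProbabilityMeasure μ] (h : LpLe μ p f B) {q : ℝ≥0∞} (hq : q ≤ p) :
    LpLe μ q f B :=
  ⟨h.measurable, h.nonneg,
    (eLpNorm_le_eLpNorm_of_exponent_le hq h.measurable.aestronglyMeasurable).trans h.le⟩

theorem add (hf : LpLe μ p f B) (hg : LpLe μ p g C) (hp : 1 ≤ p) :
    LpLe μ p (fun x => f x + g x) (B + C) := by
  refine ⟨hf.measurable.add hg.measurable, add_nonneg hf.nonneg hg.nonneg, ?_⟩
  rw [ENNReal.ofReal_add hf.nonneg hg.nonneg]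
  exact (eLpNorm_add_le hf.measurable.aestronglyMeasurable hg.measurable.aestronglyMeasurable
    hp).trans (add_le_add hf.le hg.le)

theorem const_mul (hf : LpLe μ p f B) (c : ℝ) : LpLe μ p (fun x => c * f x) (|c| * B) := by
  refine ⟨hf.measurable.const_mul c, mul_nonneg (abs_nonneg c) hf.nonneg, ?_⟩
  have := eLpNorm_const_smul (p := p) (μ := μ) c f
  have h2 : (fun x => c * f x) = c • f := rfl
  rw [h2, this, ENNReal.ofReal_mul (abs_nonneg c), Real.enorm_eq_ofReal_abs]
  gcongr
  exact hf.le

theorem const [IsProbabilityMeasure μ] (c : ℝ) : LpLe μ p (fun _ : α => c) |c| := by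
  refine ⟨measurable_const, abs_nonneg c, ?_⟩
  rw [← Real.enorm_eq_ofReal_abs]
  by_cases hp : p = 0
  · simp [hp]
  · rw [eLpNorm_const c hp (IsProbabilityMeasure.ne_zero μ)]
    simp

theorem mul (hf : LpLe μ (8 : ℕ) f B) (hg : LpLe μ (8 : ℕ) g C) :
    LpLe μ (4 : ℕ) (fun x => f x * g x) (B * C) := by
  simp only [Nat.cast_ofNat] at *
  refine ⟨hf.measurable.mul hg.measurable, mul_nonneg hf.nonneg hg.nonneg, ?_⟩
  have hH : ENNReal.HolderTriple 8 8 4 := by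
    constructor
    rw [← two_mul, show (8 : ℝ≥0∞) = 2 * 4 by norm_num, ENNReal.mul_inv (by simp) (by simp), ← mul_assoc,
      ENNReal.mul_inv_cancel (by simp) (by simp), one_mul]
  have := eLpNorm_smul_le_mul_eLpNorm (p := 8) (q := 8) (r := 4) (μ := μ)
    hg.measurable.aestronglyMeasurable hf.measurable.aestronglyMeasurable
  rw [ENNReal.ofReal_mul hf.nonneg]
  exact this.trans (mul_le_mul' hf.le hg.le)

theorem lintegral_le {n : ℕ} (hn : n ≠ 0) (hf : LpLe μ n f B) :
    ∫⁻ x, ‖f x‖ₑ ^ n ∂μ ≤ ENNReal.ofReal (B ^ n) := by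
  have h := hf.le
  rw [eLpNorm_eq_lintegral_rpow_enorm_toReal (by exact_mod_cast hn) (by simp)] at h
  simp only [ENNReal.toReal_natCast, ENNReal.rpow_natCast] at h
  have hn' : (0 : ℝ) < n := by positivity
  rw [one_div, ENNReal.rpow_inv_le_iff hn', ENNReal.rpow_natCast,
    ← ENNReal.ofReal_pow hf.nonneg] at h
  exact h

theorem of_lintegral_le {n : ℕ} (hn : n ≠ 0) (hm : Measurable f) (hB : 0 ≤ B)
    (h : ∫⁻ x, ‖f x‖ₑ ^ n ∂μ ≤ ENNReal.ofReal (B ^ n)) : LpLe μ n f B := by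
  refine ⟨hm, hB, ?_⟩
  rw [eLpNorm_eq_lintegral_rpow_enorm_toReal (by exact_mod_cast hn) (by simp)]
  simp only [ENNReal.toReal_natCast, ENNReal.rpow_natCast]
  have hn' : (0 : ℝ) < n := by positivity
  rw [one_div, ENNReal.rpow_inv_le_iff hn', ENNReal.rpow_natCast,
    ← ENNReal.ofReal_pow hB]
  exact h

theorem integrable_pow {n : ℕ} (hn : n ≠ 0) (hf : LpLe μ n f B) :
    Integrable (fun x => |f x| ^ n) μ := by
  have := hf.memLp.integrable_norm_rpow (by exact_mod_cast hn) (by simp)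
  simpa using this

theorem integral_pow_le {n : ℕ} (hn : n ≠ 0) (hf : LpLe μ n f B) :
    ∫ x, |f x| ^ n ∂μ ≤ B ^ n := by
  have h := hf.lintegral_le hn
  have hB : 0 ≤ B ^ n := pow_nonneg hf.nonneg n
  rw [integral_eq_lintegral_of_nonneg_ae (ae_of_all _ fun x => by positivity)
    (hf.integrable_pow hn).aestronglyMeasurable]
  refine ENNReal.toReal_le_of_le_ofReal hB (le_trans (le_of_eq ?_) h)
  refine lintegral_congr fun x => ?_
  rw [Real.enorm_eq_ofReal_abs, ENNReal.ofReal_pow (abs_nonneg _)]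

theorem of_integral_pow_le {n : ℕ} (hn : n ≠ 0) (hm : Measurable f) (hB : 0 ≤ B)
    (hi : Integrable (fun x => |f x| ^ n) μ) (h : ∫ x, |f x| ^ n ∂μ ≤ B ^ n) :
    LpLe μ n f B := by
  refine of_lintegral_le hn hm hB ?_
  refine le_trans (le_of_eq ?_) (ENNReal.ofReal_le_ofReal h)
  rw [ofReal_integral_eq_lintegral_ofReal hi (ae_of_all _ fun x => by positivity)]
  refine lintegral_congr fun x => ?_
  rw [Real.enorm_eq_ofReal_abs, ENNReal.ofReal_pow (abs_nonneg _)]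

end LpLe

/-- Hölder with weights `m/(m+2)` and `2/(m+2)`. It controls the second-order term in the
two-smoothness expansion, and with `m = 2` it gives `E[f² D²] ≤ ‖f‖₄² ‖D‖₄²` in the final estimates.
-/
theorem integral_pow_mul_sq_le {f D : α → ℝ} {a b : ℝ} {m : ℕ}
    (hf : LpLe μ (m + 2 : ℕ) f a) (hD : LpLe μ (m + 2 : ℕ) D b) :
    Integrable (fun x => |f x| ^ m * |D x| ^ 2) μ ∧
      ∫ x, |f x| ^ m * |D x| ^ 2 ∂μ ≤ a ^ m * b ^ 2 := by
  have hn : m + 2 ≠ 0 := by omega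
  have hi : Integrable (fun x => |f x| ^ m * |D x| ^ 2) μ := by
    refine ((hf.integrable_pow hn).add (hD.integrable_pow hn)).mono'
      (by have := hf.measurable; have := hD.measurable; fun_prop) (ae_of_all _ fun x => ?_)
    simp only [Real.norm_eq_abs, Pi.add_apply, abs_mul, abs_pow, abs_abs]
    rcases le_total |f x| |D x| with h | h
    · calc |f x| ^ m * |D x| ^ 2 ≤ |D x| ^ m * |D x| ^ 2 := by gcongr
        _ = |D x| ^ (m + 2) := by ring
        _ ≤ _ := le_add_of_nonneg_left (by positivity)
    · calc |f x| ^ m * |D x| ^ 2 ≤ |f x| ^ m * |f x| ^ 2 := by gcongr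
        _ = |f x| ^ (m + 2) := by ring
        _ ≤ _ := le_add_of_nonneg_right (by positivity)
  refine ⟨hi, ?_⟩
  rw [integral_eq_lintegral_of_nonneg_ae (ae_of_all _ fun x => by positivity)
    hi.aestronglyMeasurable]
  have ha := hf.nonneg
  have hb := hD.nonneg
  refine ENNReal.toReal_le_of_le_ofReal (by positivity) ?_
  have hq : (0 : ℝ) < (m + 2 : ℕ) := by positivity
  have key := ENNReal.lintegral_mul_norm_pow_le (μ := μ)
    (f := fun x => ‖f x‖ₑ ^ (m + 2)) (g := fun x => ‖D x‖ₑ ^ (m + 2))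
    (by have := hf.measurable; fun_prop) (by have := hD.measurable; fun_prop)
    (p := (m : ℝ) / (m + 2 : ℕ)) (q := 2 / (m + 2 : ℕ)) (by positivity) (by positivity)
    (by push_cast; field_simp)
  have e1 : ∀ z : ℝ≥0∞, (z ^ (m + 2)) ^ ((m : ℝ) / (m + 2 : ℕ)) = z ^ m := by
    intro z
    rw [← ENNReal.rpow_natCast z (m + 2), ← ENNReal.rpow_mul, mul_div_cancel₀ _ hq.ne',
      ENNReal.rpow_natCast]
  have e2 : ∀ z : ℝ≥0∞, (z ^ (m + 2)) ^ ((2 : ℝ) / (m + 2 : ℕ)) = z ^ 2 := by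
    intro z
    rw [← ENNReal.rpow_natCast z (m + 2), ← ENNReal.rpow_mul, mul_div_cancel₀ _ hq.ne']
    exact ENNReal.rpow_ofNat z 2
  simp only [e1, e2] at key
  calc ∫⁻ x, ENNReal.ofReal (|f x| ^ m * |D x| ^ 2) ∂μ
      = ∫⁻ x, ‖f x‖ₑ ^ m * ‖D x‖ₑ ^ 2 ∂μ := by
        refine lintegral_congr fun x => ?_
        rw [Real.enorm_eq_ofReal_abs, Real.enorm_eq_ofReal_abs, ENNReal.ofReal_mul (by positivity),
          ENNReal.ofReal_pow (abs_nonneg _), ENNReal.ofReal_pow (abs_nonneg _)]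
    _ ≤ _ := key
    _ ≤ (ENNReal.ofReal (a ^ (m + 2))) ^ ((m : ℝ) / (m + 2 : ℕ)) *
        (ENNReal.ofReal (b ^ (m + 2))) ^ ((2 : ℝ) / (m + 2 : ℕ)) := by
        gcongr
        · exact hf.lintegral_le hn
        · exact hD.lintegral_le hn
    _ = ENNReal.ofReal (a ^ m * b ^ 2) := by
        rw [ENNReal.ofReal_pow ha, ENNReal.ofReal_pow hb, e1, e2,
          ENNReal.ofReal_mul (by positivity), ENNReal.ofReal_pow ha, ENNReal.ofReal_pow hb]

end LpLe

/-! ### Two-smoothness of `L⁴` and `L⁸`, and telescoping over coordinates. -/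

section Smoothness

variable {ι : Type*} [Fintype ι] [DecidableEq ι] {ν : ι → Measure ℝ}
  [∀ i, IsProbabilityMeasure (ν i)]

/-- The factors are independent, so no Hölder loss occurs and the exponent is kept. -/
theorem FreeOf.lpLe_mul {k : ι} {g : (ι → ℝ) → ℝ} (hg : FreeOf k g) {η : ℝ → ℝ} {n : ℕ}
    (hn : n ≠ 0) {B C : ℝ} (hη : LpLe (ν k) n η B) (hgC : LpLe (Measure.pi ν) n g C) :
    LpLe (Measure.pi ν) n (fun x => η (x k) * g x) (B * C) := by
  have h1 := hη.measurable
  have h2 := hgC.measurable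
  refine LpLe.of_lintegral_le hn (by fun_prop) (mul_nonneg hη.nonneg hgC.nonneg) ?_
  have := hg.lintegral_mul (ν := ν) h2 h1 n (Nat.cast_nonneg n)
  simp only [ENNReal.rpow_natCast] at this
  rw [this, mul_pow, ENNReal.ofReal_mul (pow_nonneg hη.nonneg n)]
  exact mul_le_mul' (hη.lintegral_le hn) (hgC.lintegral_le hn)

/-- Integrate the Taylor-type inequality `hpt` at `(f, D)`: the linear term vanishes because `D` is
centered in a coordinate on which `f` does not depend, and the mixed term is handled by Hölder. -/
theorem FreeOf.integral_pow_add_le {k : ι} {f D : (ι → ℝ) → ℝ} (hf : FreeOf k f)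
    (hD : Centered ν k D) {m : ℕ} (hm : Even m) {c : ℝ} (hc : 0 ≤ c)
    (hpt : ∀ x d : ℝ, (x + d) ^ (m + 2) ≤
      x ^ (m + 2) + (m + 2) * (x ^ (m + 1) * d) + c * (x ^ m * d ^ 2 + d ^ (m + 2)))
    {a b : ℝ} (ha : LpLe (Measure.pi ν) (m + 2 : ℕ) f a)
    (hb : LpLe (Measure.pi ν) (m + 2 : ℕ) D b) :
    ∫ x, |f x + D x| ^ (m + 2) ∂(Measure.pi ν) ≤
      a ^ (m + 2) + c * (a ^ m * b ^ 2 + b ^ (m + 2)) := by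
  have hn : m + 2 ≠ 0 := by omega
  have hm2 : Even (m + 2) := hm.add even_two
  obtain ⟨hi, hle⟩ := integral_pow_mul_sq_le ha hb
  have hia := ha.integrable_pow hn
  have hib := hb.integrable_pow hn
  have hla := ha.integral_pow_le hn
  have hlb := hb.integral_pow_le hn
  simp only [hm.pow_abs, hm2.pow_abs, sq_abs] at *
  have hsum : LpLe (Measure.pi ν) (m + 2 : ℕ) (fun x => f x + D x) (a + b) :=
    ha.add hb (by norm_cast; omega)
  have his := hsum.integrable_pow hn
  simp only [hm2.pow_abs] at his
  have hlin : Integrable (fun x => f x ^ (m + 1) * D x) (Measure.pi ν) := by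
    refine (hia.add hi).mono' (by have := ha.measurable; have := hb.measurable; fun_prop)
      (ae_of_all _ fun x => ?_)
    simp only [Real.norm_eq_abs, Pi.add_apply]
    have h1 : f x ^ (m + 2) + f x ^ m * D x ^ 2 = |f x| ^ m * (|f x| ^ 2 + |D x| ^ 2) := by
      rw [hm.pow_abs, sq_abs, sq_abs]; ring
    rw [h1, abs_mul, abs_pow, pow_succ, mul_assoc]
    gcongr
    nlinarith [sq_nonneg (|f x| - |D x|), abs_nonneg (f x), abs_nonneg (D x)]
  have h0 : ∫ x, f x ^ (m + 1) * D x ∂(Measure.pi ν) = 0 :=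
    hD.integral_mul_eq_zero (g := fun x => f x ^ (m + 1)) (fun x y => by simp only [hf x y]) hlin
  have hR1 : Integrable (fun x => f x ^ (m + 2) + (m + 2) * (f x ^ (m + 1) * D x))
      (Measure.pi ν) := hia.add (hlin.const_mul _)
  have hR2 : Integrable (fun x => c * (f x ^ m * D x ^ 2 + D x ^ (m + 2)))
      (Measure.pi ν) := (hi.add hib).const_mul c
  calc ∫ x, (f x + D x) ^ (m + 2) ∂(Measure.pi ν)
      ≤ ∫ x, (f x ^ (m + 2) + (m + 2) * (f x ^ (m + 1) * D x) +
          c * (f x ^ m * D x ^ 2 + D x ^ (m + 2))) ∂(Measure.pi ν) :=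
        integral_mono his (hR1.add hR2) fun x => hpt (f x) (D x)
    _ = ∫ x, f x ^ (m + 2) ∂(Measure.pi ν) + c * (∫ x, f x ^ m * D x ^ 2 ∂(Measure.pi ν) +
          ∫ x, D x ^ (m + 2) ∂(Measure.pi ν)) := by
        rw [integral_add hR1 hR2, integral_add hia (hlin.const_mul _), integral_const_mul, h0,
          integral_const_mul, integral_add hi hib]
        ring
    _ ≤ _ := by gcongr

/-- Two-smoothness of `L^4`. -/
theorem FreeOf.lpLe_add_four {k : ι} {f D : (ι → ℝ) → ℝ} (hf : FreeOf k f)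
    (hD : Centered ν k D) {a b : ℝ} (ha : LpLe (Measure.pi ν) (4 : ℕ) f a)
    (hb : LpLe (Measure.pi ν) (4 : ℕ) D b) :
    LpLe (Measure.pi ν) (4 : ℕ) (fun x => f x + D x) (√(a ^ 2 + 40 * b ^ 2)) := by
  have hs : LpLe (Measure.pi ν) (4 : ℕ) (fun x => f x + D x) (a + b) :=
    ha.add hb (by norm_num)
  refine LpLe.of_integral_pow_le (by norm_num) hs.measurable (Real.sqrt_nonneg _)
    (hs.integrable_pow (by norm_num)) ?_
  refine (hf.integral_pow_add_le hD (m := 2) even_two (c := 8) (by norm_num) ?_ ha hb).trans ?_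
  · intro x d
    push_cast
    nlinarith [sq_nonneg (x * d - d ^ 2), sq_nonneg (d ^ 2)]
  · have : (√(a ^ 2 + 40 * b ^ 2)) ^ 4 = (a ^ 2 + 40 * b ^ 2) ^ 2 := by
      rw [show 4 = 2 * 2 from rfl, pow_mul, Real.sq_sqrt (by positivity)]
    rw [this]
    simp only [Nat.reduceAdd]
    nlinarith [sq_nonneg (a * b), sq_nonneg (b ^ 2)]

/-- Two-smoothness of `L^8`. -/
theorem FreeOf.lpLe_add_eight {k : ι} {f D : (ι → ℝ) → ℝ} (hf : FreeOf k f)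
    (hD : Centered ν k D) {a b : ℝ} (ha : LpLe (Measure.pi ν) (8 : ℕ) f a)
    (hb : LpLe (Measure.pi ν) (8 : ℕ) D b) :
    LpLe (Measure.pi ν) (8 : ℕ) (fun x => f x + D x) (√(a ^ 2 + 40 * b ^ 2)) := by
  have hs : LpLe (Measure.pi ν) (8 : ℕ) (fun x => f x + D x) (a + b) :=
    ha.add hb (by norm_num)
  refine LpLe.of_integral_pow_le (by norm_num) hs.measurable (Real.sqrt_nonneg _)
    (hs.integrable_pow (by norm_num)) ?_
  -- The constant `40` is `160 / 4`: the coefficient of `a⁶ b²` in `(a² + 40 b²)⁴` is `4 · 40`. The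
  -- `L⁴` case reuses it with room to spare.
  refine (hf.integral_pow_add_le hD (m := 6) (by decide) (c := 160) (by norm_num) ?_
    ha hb).trans ?_
  · intro x d
    push_cast
    have h1 := sq_nonneg (x ^ 3 * d - x ^ 2 * d ^ 2)
    have h2 := sq_nonneg (x ^ 2 * d ^ 2 - x * d ^ 3)
    have h3 := sq_nonneg (x * d ^ 3 - d ^ 4)
    have h4 : 0 ≤ d ^ 2 * (x ^ 2 - d ^ 2) ^ 2 * (x ^ 2 + 2 * d ^ 2) := by positivity
    have h5 : 0 ≤ d ^ 2 * (x ^ 2 - d ^ 2) ^ 2 * (2 * x ^ 2 + d ^ 2) := by positivity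
    have h6 : 0 ≤ (d ^ 4) ^ 2 := by positivity
    nlinarith
  · have : (√(a ^ 2 + 40 * b ^ 2)) ^ 8 = (a ^ 2 + 40 * b ^ 2) ^ 4 := by
      rw [show 8 = 2 * 4 from rfl, pow_mul, Real.sq_sqrt (by positivity)]
    rw [this]
    have h1 : 0 ≤ a ^ 4 * b ^ 4 := by positivity
    have h2 : 0 ≤ a ^ 2 * b ^ 6 := by positivity
    have h3 : 0 ≤ b ^ 8 := by positivity
    simp only [Nat.reduceAdd]
    nlinarith

/-- A family of statistics indexed by finite sets of coordinates, growing by centered increments. -/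
structure IsTelescope (ν : ι → Measure ℝ) (f : Finset ι → (ι → ℝ) → ℝ)
    (D : ι → Finset ι → (ι → ℝ) → ℝ) : Prop where
  insert_eq : ∀ k S, k ∉ S → ∀ x, f (insert k S) x = f S x + D k S x
  freeOf : ∀ k S, k ∉ S → FreeOf k (f S)
  centered : ∀ k S, k ∉ S → Centered ν k (D k S)

namespace IsTelescope

variable {f : Finset ι → (ι → ℝ) → ℝ} {D : ι → Finset ι → (ι → ℝ) → ℝ}

theorem lpLe (h : IsTelescope ν f D) {n : ℕ} (hn : n = 4 ∨ n = 8) {c : ℝ} {b : ι → ℝ}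
    (h0 : LpLe (Measure.pi ν) n (f ∅) c)
    (hb : ∀ k S, k ∉ S → LpLe (Measure.pi ν) n (D k S) (b k)) (S : Finset ι) :
    LpLe (Measure.pi ν) n (f S) (√(c ^ 2 + 40 * ∑ k ∈ S, b k ^ 2)) := by
  induction S using Finset.induction_on with
  | empty =>
    simpa [Real.sqrt_sq h0.nonneg] using h0
  | insert k S hk ih =>
    have hval : (√(c ^ 2 + 40 * ∑ k ∈ S, b k ^ 2)) ^ 2 + 40 * b k ^ 2 =
        c ^ 2 + 40 * ∑ k ∈ insert k S, b k ^ 2 := by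
      rw [Real.sq_sqrt (by positivity), Finset.sum_insert hk]
      ring
    rw [← hval]
    refine LpLe.of_eq ?_ fun x => (h.insert_eq k S hk x).symm
    rcases hn with rfl | rfl
    · exact (h.freeOf k S hk).lpLe_add_four (h.centered k S hk) ih (hb k S hk)
    · exact (h.freeOf k S hk).lpLe_add_eight (h.centered k S hk) ih (hb k S hk)

theorem integral_eq (h : IsTelescope ν f D) (h0 : Integrable (f ∅) (Measure.pi ν))
    (hb : ∀ k S, k ∉ S → Integrable (D k S) (Measure.pi ν)) (S : Finset ι) :
    Integrable (f S) (Measure.pi ν) ∧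
      ∫ x, f S x ∂(Measure.pi ν) = ∫ x, f ∅ x ∂(Measure.pi ν) := by
  induction S using Finset.induction_on with
  | empty => exact ⟨h0, rfl⟩
  | insert k S hk ih =>
    have heq : f (insert k S) = fun x => f S x + D k S x := funext (h.insert_eq k S hk)
    rw [heq]
    refine ⟨ih.1.add (hb k S hk), ?_⟩
    rw [integral_add ih.1 (hb k S hk), ih.2, (h.centered k S hk).integral_eq_zero (hb k S hk),
      add_zero]

/-- Increments are orthogonal to the past, so in `L²` the telescope is exact rather than an
inequality. -/
theorem integral_sq_eq (h : IsTelescope ν f D) (h0 : MemLp (f ∅) 2 (Measure.pi ν))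
    (hb : ∀ k S, k ∉ S → MemLp (D k S) 2 (Measure.pi ν)) {v : Finset ι → ℝ}
    (hv0 : ∫ x, f ∅ x ^ 2 ∂(Measure.pi ν) = v ∅)
    (hv : ∀ k S, k ∉ S → v (insert k S) = v S + ∫ x, D k S x ^ 2 ∂(Measure.pi ν))
    (S : Finset ι) :
    MemLp (f S) 2 (Measure.pi ν) ∧ ∫ x, f S x ^ 2 ∂(Measure.pi ν) = v S := by
  induction S using Finset.induction_on with
  | empty => exact ⟨h0, hv0⟩
  | insert k S hk ih =>
    have heq : f (insert k S) = fun x => f S x + D k S x := funext (h.insert_eq k S hk)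
    rw [heq]
    refine ⟨ih.1.add (hb k S hk), ?_⟩
    have hi : Integrable (fun x => f S x * D k S x) (Measure.pi ν) :=
      ih.1.integrable_mul (hb k S hk)
    have hi2 : Integrable (fun x => f S x ^ 2 + 2 * (f S x * D k S x)) (Measure.pi ν) :=
      ih.1.integrable_sq.add (hi.const_mul 2)
    have h1 : ∀ x, (f S x + D k S x) ^ 2 = f S x ^ 2 + 2 * (f S x * D k S x) + D k S x ^ 2 :=
      fun x => by ring
    simp only [h1]
    rw [integral_add hi2 (hb k S hk).integrable_sq,
      integral_add ih.1.integrable_sq (hi.const_mul 2), integral_const_mul, ih.2,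
      (h.centered k S hk).integral_mul_eq_zero (h.freeOf k S hk) hi, hv k S hk]
    ring

end IsTelescope

end Smoothness

/-! ### Partially averaged quadratic statistics -/

section Parts

variable {ι : Type*} [Fintype ι] [DecidableEq ι] {ν : ι → Measure ℝ}
  [∀ i, IsProbabilityMeasure (ν i)]

/-- `∑_{v ∈ S} a_{kv} x_v` -/
def linPart (a : ι → ι → ℝ) (S : Finset ι) (k : ι) (x : ι → ℝ) : ℝ := ∑ v ∈ S, a k v * x v

/-- `∑_u b_u t_u(x_u)` with `t_u` replaced by its mean `1` for `u ∉ S` -/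
def kerSum (t : ι → ℝ → ℝ) (b : ι → ℝ) (S : Finset ι) (x : ι → ℝ) : ℝ :=
  ∑ u, b u + ∑ u ∈ S, b u * (t u (x u) - 1)

/-- `∑_u a_{ku} t_u(x_u) (∑_v a_{uv} x_v)` averaged over the coordinates outside `S` -/
def biPart (a : ι → ι → ℝ) (t : ι → ℝ → ℝ) (S : Finset ι) (k : ι) (x : ι → ℝ) : ℝ :=
  ∑ u, a k u * linPart a S u x + ∑ u ∈ S, a k u * (t u (x u) - 1) * linPart a S u x

/-- `(1/2) ∑_{u,v} a_{uv} x_u x_v` averaged over the coordinates outside `S` -/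
noncomputable def quadPart (a : ι → ι → ℝ) (S : Finset ι) (x : ι → ℝ) : ℝ :=
  ∑ u ∈ S, 1 / 2 * x u * linPart a S u x

/-- `(∑_v a_{uv} x_v)²` averaged over the coordinates outside `S` -/
def sqPart (a : ι → ι → ℝ) (S : Finset ι) (u : ι) (x : ι → ℝ) : ℝ :=
  linPart a S u x ^ 2 + (∑ v, a u v ^ 2 - ∑ v ∈ S, a u v ^ 2)

/-- `(1/2) ∑_u t_u(x_u) (∑_v a_{uv} x_v)²` averaged over the coordinates outside `S` -/
noncomputable def thetaPart (a : ι → ι → ℝ) (t : ι → ℝ → ℝ) (S : Finset ι) (x : ι → ℝ) : ℝ :=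
  1 / 2 * (∑ u, sqPart a S u x + ∑ u ∈ S, (t u (x u) - 1) * sqPart a S u x)

/-- The row sum of squares `∑_v a_{kv}²`. -/
def rowSq (a : ι → ι → ℝ) (k : ι) : ℝ := ∑ v, a k v ^ 2

theorem rowSq_nonneg (a : ι → ι → ℝ) (k : ι) : 0 ≤ rowSq a k :=
  Finset.sum_nonneg fun _ _ => sq_nonneg _

/-- A bound for the `L^4` norm of `biPart`. -/
noncomputable def biBound (a : ι → ι → ℝ) (B : ℝ) (w : ι) : ℝ :=
  √(∑ k, (80 * B ^ 2 * ((∑ u, a w u * a u k) ^ 2 +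
      160 * B ^ 2 * ∑ u, (a w u * a u k) ^ 2) +
    80 * 196 * B ^ 4 * (a w k ^ 2 * rowSq a k)))

/-- `∑_k (∑_v a_{kv}²)² + ∑_{u,v} (∑_k a_{ku} a_{kv})²` -/
def fourthSum (a : ι → ι → ℝ) : ℝ :=
  ∑ k, (∑ v, a k v ^ 2) ^ 2 + ∑ u, ∑ v, (∑ k, a k u * a k v) ^ 2

variable {a : ι → ι → ℝ} {t : ι → ℝ → ℝ} {S : Finset ι} {k : ι}

/-! ### Increments caused by revealing one coordinate. -/

theorem linPart_insert (hk : k ∉ S) (u : ι) (x : ι → ℝ) :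
    linPart a (insert k S) u x = linPart a S u x + a u k * x k := by
  rw [linPart, Finset.sum_insert hk, add_comm, linPart]

theorem kerSum_insert (hk : k ∉ S) (b : ι → ℝ) (x : ι → ℝ) :
    kerSum t b (insert k S) x = kerSum t b S x + (t k (x k) - 1) * b k := by
  rw [kerSum, Finset.sum_insert hk, kerSum]
  ring

theorem biPart_insert (hdiag : ∀ u, a u u = 0) (hk : k ∉ S) (w : ι) (x : ι → ℝ) :
    biPart a t (insert k S) w x = biPart a t S w x +
      (x k * kerSum t (fun u => a w u * a u k) S x +
        (t k (x k) - 1) * (a w k * linPart a S k x)) := by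
  simp only [biPart, kerSum, linPart_insert hk, Finset.sum_insert hk, hdiag, mul_add,
    Finset.sum_add_distrib, Finset.mul_sum]
  have h1 : ∀ u, a w u * (a u k * x k) = x k * (a w u * a u k) := fun u => by ring
  have h2 : ∀ u, a w u * (t u (x u) - 1) * (a u k * x k) =
      x k * (a w u * a u k * (t u (x u) - 1)) := fun u => by ring
  simp only [h1, h2]
  ring

theorem quadPart_insert (hsymm : ∀ u v, a u v = a v u) (hdiag : ∀ u, a u u = 0) (hk : k ∉ S)
    (x : ι → ℝ) :
    quadPart a (insert k S) x = quadPart a S x + x k * linPart a S k x := by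
  simp only [quadPart, linPart_insert hk, Finset.sum_insert hk, hdiag, mul_add,
    Finset.sum_add_distrib]
  have h1 : ∑ u ∈ S, 1 / 2 * x u * (a u k * x k) = 1 / 2 * x k * linPart a S k x := by
    rw [linPart, Finset.mul_sum]
    refine Finset.sum_congr rfl fun u _ => ?_
    rw [hsymm u k]
    ring
  rw [h1]
  ring

theorem sqPart_insert (hk : k ∉ S) (u : ι) (x : ι → ℝ) :
    sqPart a (insert k S) u x = sqPart a S u x +
      (2 * x k * (a u k * linPart a S u x) + (x k ^ 2 - 1) * a u k ^ 2) := by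
  rw [sqPart, sqPart, linPart_insert hk, Finset.sum_insert hk]
  ring

/-- The zero diagonal prevents `x k` from multiplying `t k (x k)`, so the increment splits into the
three functions `x k`, `x k ^ 2 - 1`, `t k (x k) - 1`, each multiplied by a statistic free of
coordinate `k`. All three become centered under the moment assumptions. -/
theorem thetaPart_insert (hsymm : ∀ u v, a u v = a v u) (hdiag : ∀ u, a u u = 0) (hk : k ∉ S)
    (x : ι → ℝ) :
    thetaPart a t (insert k S) x = thetaPart a t S x +
      (x k * biPart a t S k x + (x k ^ 2 - 1) * (1 / 2 * kerSum t (fun u => a k u ^ 2) S x) +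
        (t k (x k) - 1) * (1 / 2 * sqPart a S k x)) := by
  simp only [thetaPart, biPart, kerSum, sqPart_insert hk, Finset.sum_insert hk, hdiag, mul_add,
    Finset.sum_add_distrib, Finset.mul_sum]
  have h1 : ∀ u, 1 / 2 * (2 * x k * (a u k * linPart a S u x)) =
      x k * (a k u * linPart a S u x) := fun u => by rw [hsymm u k]; ring
  have h2 : ∀ u, 1 / 2 * ((x k ^ 2 - 1) * a u k ^ 2) =
      (x k ^ 2 - 1) * (1 / 2 * a k u ^ 2) := fun u => by rw [hsymm u k]; ring
  have h3 : ∀ u, 1 / 2 * ((t u (x u) - 1) * (2 * x k * (a u k * linPart a S u x))) =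
      x k * (a k u * (t u (x u) - 1) * linPart a S u x) := fun u => by rw [hsymm u k]; ring
  have h4 : ∀ u, 1 / 2 * ((t u (x u) - 1) * ((x k ^ 2 - 1) * a u k ^ 2)) =
      (x k ^ 2 - 1) * (1 / 2 * (a k u ^ 2 * (t u (x u) - 1))) := fun u => by rw [hsymm u k]; ring
  simp only [h1, h2, h3, h4]
  ring

theorem freeOf_linPart (hk : k ∉ S) (u : ι) : FreeOf k (linPart a S u) := fun x y =>
  Finset.sum_congr rfl fun v hv => by
    rw [Function.update_of_ne (ne_of_mem_of_not_mem hv hk)]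

theorem freeOf_linPart_self (hdiag : ∀ u, a u u = 0) (S : Finset ι) (k : ι) :
    FreeOf k (linPart a S k) := fun x y =>
  Finset.sum_congr rfl fun v _ => by
    rcases eq_or_ne v k with rfl | h
    · simp [hdiag]
    · rw [Function.update_of_ne h]

theorem freeOf_kerSum (hk : k ∉ S) (b : ι → ℝ) : FreeOf k (kerSum t b S) := fun x y => by
  unfold kerSum
  congr 1
  exact Finset.sum_congr rfl fun v hv => by
    rw [Function.update_of_ne (ne_of_mem_of_not_mem hv hk)]

theorem freeOf_biPart (hk : k ∉ S) (w : ι) : FreeOf k (biPart a t S w) := fun x y => by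
  unfold biPart
  simp only [freeOf_linPart hk _ x y]
  congr 1
  exact Finset.sum_congr rfl fun v hv => by
    rw [Function.update_of_ne (ne_of_mem_of_not_mem hv hk)]

theorem freeOf_quadPart (hk : k ∉ S) : FreeOf k (quadPart a S) := fun x y => by
  unfold quadPart
  simp only [freeOf_linPart hk _ x y]
  exact Finset.sum_congr rfl fun v hv => by
    rw [Function.update_of_ne (ne_of_mem_of_not_mem hv hk)]

theorem freeOf_sqPart (hk : k ∉ S) (u : ι) : FreeOf k (sqPart a S u) := fun x y => by
  unfold sqPart
  simp only [freeOf_linPart hk _ x y]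

theorem freeOf_thetaPart (hk : k ∉ S) : FreeOf k (thetaPart a t S) := fun x y => by
  unfold thetaPart
  simp only [freeOf_sqPart hk _ x y]
  congr 2
  exact Finset.sum_congr rfl fun v hv => by
    rw [Function.update_of_ne (ne_of_mem_of_not_mem hv hk)]

theorem sum_rowSq_sq_le (a : ι → ι → ℝ) : ∑ k, rowSq a k ^ 2 ≤ fourthSum a :=
  le_add_of_nonneg_right (Finset.sum_nonneg fun _ _ => Finset.sum_nonneg fun _ _ => sq_nonneg _)

theorem fourthSum_nonneg (a : ι → ι → ℝ) : 0 ≤ fourthSum a :=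
  (Finset.sum_nonneg fun _ _ => sq_nonneg _).trans (sum_rowSq_sq_le a)

/-- By symmetry the squared entries of the matrix square give the second part of `fourthSum`, while
both remaining sums collapse to `∑ rowSq²`. The constant is `80 · 160 + 80 · 196`. -/
theorem sum_biBound_sq_le (hsymm : ∀ u v, a u v = a v u) {B : ℝ} (hB : 1 ≤ B) :
    ∑ w, biBound a B w ^ 2 ≤ 28480 * B ^ 4 * fourthSum a := by
  have hsq : ∀ w, biBound a B w ^ 2 = ∑ k, (80 * B ^ 2 * ((∑ u, a w u * a u k) ^ 2 +
      160 * B ^ 2 * ∑ u, (a w u * a u k) ^ 2) + 80 * 196 * B ^ 4 * (a w k ^ 2 * rowSq a k)) := by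
    intro w
    refine Real.sq_sqrt (Finset.sum_nonneg fun k _ => ?_)
    have h1 : 0 ≤ ∑ u, (a w u * a u k) ^ 2 := Finset.sum_nonneg fun _ _ => sq_nonneg _
    have h2 := rowSq_nonneg a k
    positivity
  have e1 : ∑ w, ∑ k, (∑ u, a w u * a u k) ^ 2 = ∑ u, ∑ v, (∑ k, a k u * a k v) ^ 2 := by
    refine Finset.sum_congr rfl fun w _ => Finset.sum_congr rfl fun k _ => ?_
    congr 1
    exact Finset.sum_congr rfl fun u _ => by rw [hsymm w u]
  have e2 : ∑ w, ∑ k, ∑ u, (a w u * a u k) ^ 2 = ∑ u, rowSq a u ^ 2 := by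
    have : ∀ w, ∑ k, ∑ u, (a w u * a u k) ^ 2 = ∑ u, a w u ^ 2 * rowSq a u := by
      intro w
      rw [Finset.sum_comm]
      refine Finset.sum_congr rfl fun u _ => ?_
      rw [rowSq, Finset.mul_sum]
      exact Finset.sum_congr rfl fun k _ => by ring
    simp only [this]
    rw [Finset.sum_comm]
    refine Finset.sum_congr rfl fun u _ => ?_
    rw [← Finset.sum_mul, sq]
    congr 1
    exact Finset.sum_congr rfl fun w _ => by rw [hsymm w u]
  have e3 : ∑ w, ∑ k, a w k ^ 2 * rowSq a k = ∑ u, rowSq a u ^ 2 := by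
    rw [Finset.sum_comm]
    refine Finset.sum_congr rfl fun u _ => ?_
    rw [← Finset.sum_mul, sq]
    congr 1
    exact Finset.sum_congr rfl fun w _ => by rw [hsymm w u]
  simp only [hsq, Finset.sum_add_distrib, ← Finset.mul_sum, e1, e2, e3]
  have h0 : 0 ≤ ∑ u, ∑ v, (∑ k, a k u * a k v) ^ 2 :=
    Finset.sum_nonneg fun _ _ => Finset.sum_nonneg fun _ _ => sq_nonneg _
  have h1 : fourthSum a = ∑ k, rowSq a k ^ 2 + ∑ u, ∑ v, (∑ k, a k u * a k v) ^ 2 := rfl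
  rw [h1]
  generalize ∑ u, ∑ v, (∑ k, a k u * a k v) ^ 2 = M at *
  generalize ∑ u, rowSq a u ^ 2 = r at *
  have h2 : B ^ 2 * M ≤ B ^ 4 * M :=
    mul_le_mul_of_nonneg_right (pow_le_pow_right₀ hB (by norm_num)) h0
  have h3 : 0 ≤ B ^ 2 * M := by positivity
  nlinarith

/-- Moment assumptions on the coordinates and on their Stein kernels. -/
structure KernelMoments (ν : ι → Measure ℝ) (t : ι → ℝ → ℝ) (B : ℝ) : Prop where
  one_le : 1 ≤ B
  lpLe_id : ∀ u, LpLe (ν u) (8 : ℕ) (fun y => y) B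
  lpLe_kernel : ∀ u, LpLe (ν u) (8 : ℕ) (t u) B
  mean : ∀ u, ∫ y, y ∂(ν u) = 0
  second_moment : ∀ u, ∫ y, y ^ 2 ∂(ν u) = 1
  mean_kernel : ∀ u, ∫ y, t u y ∂(ν u) = 1

/-! ### Norms and moments of the partially averaged statistics. -/

namespace KernelMoments

variable {B : ℝ}

theorem nonneg (h : KernelMoments ν t B) : 0 ≤ B := zero_le_one.trans h.one_le

theorem lpLe_id_four (h : KernelMoments ν t B) (u : ι) : LpLe (ν u) (4 : ℕ) (fun y => y) B :=
  (h.lpLe_id u).exponent_mono (by norm_num)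

theorem lpLe_kernel_sub (h : KernelMoments ν t B) (u : ι) : LpLe (ν u) (8 : ℕ)
    (fun y => t u y - 1) (2 * B) := by
  have := (h.lpLe_kernel u).add (LpLe.const (-1)) (by norm_num)
  refine (this.mono ?_).of_eq fun x => by ring
  have := h.one_le
  norm_num
  linarith

theorem lpLe_kernel_sub_four (h : KernelMoments ν t B) (u : ι) : LpLe (ν u) (4 : ℕ)
    (fun y => t u y - 1) (2 * B) :=
  (h.lpLe_kernel_sub u).exponent_mono (by norm_num)

theorem lpLe_sq_sub (h : KernelMoments ν t B) (u : ι) : LpLe (ν u) (4 : ℕ) (fun y => y ^ 2 - 1)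
    (2 * B ^ 2) := by
  have := ((h.lpLe_id u).mul (h.lpLe_id u)).add (LpLe.const (-1)) (by norm_num)
  refine (this.mono ?_).of_eq fun x => by ring
  have := h.one_le
  norm_num
  nlinarith

theorem integrable_id (h : KernelMoments ν t B) (u : ι) : Integrable (fun y => y) (ν u) :=
  (h.lpLe_id u).memLp.integrable (by norm_num)

theorem integrable_kernel_sub (h : KernelMoments ν t B) (u : ι) : Integrable
    (fun y => t u y - 1) (ν u) :=
  (h.lpLe_kernel_sub u).memLp.integrable (by norm_num)

theorem integrable_sq_sub (h : KernelMoments ν t B) (u : ι) : Integrable (fun y => y ^ 2 - 1)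
    (ν u) :=
  (h.lpLe_sq_sub u).memLp.integrable (by norm_num)

theorem integral_kernel_sub (h : KernelMoments ν t B) (u : ι) : ∫ y, (t u y - 1) ∂(ν u) = 0 := by
  rw [integral_sub ((h.lpLe_kernel u).memLp.integrable (by norm_num)) (integrable_const _),
    h.mean_kernel]
  simp

theorem integral_sq_sub (h : KernelMoments ν t B) (u : ι) : ∫ y, (y ^ 2 - 1) ∂(ν u) = 0 := by
  rw [integral_sub _ (integrable_const _), h.second_moment]
  · simp
  · have := (h.integrable_sq_sub u).add (integrable_const (1 : ℝ))
    simpa [Pi.add_def] using this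

theorem isTelescope_linPart (h : KernelMoments ν t B) (w : ι) :
    IsTelescope ν (fun S => linPart a S w) (fun k _ x => x k * a w k) where
  insert_eq k S hk x := by rw [linPart_insert hk, mul_comm]
  freeOf k S hk := freeOf_linPart hk w
  centered k S hk := FreeOf.centered_mul (g := fun _ => a w k) (fun _ _ => rfl)
    (h.integrable_id k) (h.mean k)

theorem isTelescope_kerSum (h : KernelMoments ν t B) (b : ι → ℝ) :
    IsTelescope ν (kerSum t b) (fun k _ x => (t k (x k) - 1) * b k) where
  insert_eq k S hk x := kerSum_insert hk b x
  freeOf k S hk := freeOf_kerSum hk b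
  centered k S hk := FreeOf.centered_mul (η := fun y => t k y - 1) (g := fun _ => b k)
    (fun _ _ => rfl) (h.integrable_kernel_sub k) (h.integral_kernel_sub k)

theorem isTelescope_biPart (h : KernelMoments ν t B) (hdiag : ∀ u, a u u = 0) (w : ι) :
    IsTelescope ν (fun S => biPart a t S w) (fun k S x =>
      x k * kerSum t (fun u => a w u * a u k) S x +
        (t k (x k) - 1) * (a w k * linPart a S k x)) where
  insert_eq k S hk x := biPart_insert hdiag hk w x
  freeOf k S hk := freeOf_biPart hk w
  centered k S hk := by
    refine Centered.add ?_ ?_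
    · exact (freeOf_kerSum hk _).centered_mul (h.integrable_id k) (h.mean k)
    · refine FreeOf.centered_mul (η := fun y => t k y - 1)
        (g := fun x => a w k * linPart a S k x) (fun x y => ?_)
        (h.integrable_kernel_sub k) (h.integral_kernel_sub k)
      simp only [freeOf_linPart hk k x y]

theorem isTelescope_quadPart (h : KernelMoments ν t B) (hsymm : ∀ u v, a u v = a v u)
    (hdiag : ∀ u, a u u = 0) :
    IsTelescope ν (quadPart a) (fun k S x => x k * linPart a S k x) where
  insert_eq k S hk x := quadPart_insert hsymm hdiag hk x
  freeOf k S hk := freeOf_quadPart hk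
  centered k S hk := (freeOf_linPart hk k).centered_mul (h.integrable_id k) (h.mean k)

theorem isTelescope_thetaPart (h : KernelMoments ν t B) (hsymm : ∀ u v, a u v = a v u)
    (hdiag : ∀ u, a u u = 0) (c : ℝ) :
    IsTelescope ν (fun S x => thetaPart a t S x - c) (fun k S x =>
      x k * biPart a t S k x + (x k ^ 2 - 1) * (1 / 2 * kerSum t (fun u => a k u ^ 2) S x) +
        (t k (x k) - 1) * (1 / 2 * sqPart a S k x)) where
  insert_eq k S hk x := by
    rw [thetaPart_insert hsymm hdiag hk x]
    ring
  freeOf k S hk x y := by simp only [freeOf_thetaPart hk x y]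
  centered k S hk := by
    refine Centered.add (Centered.add ?_ ?_) ?_
    · exact (freeOf_biPart hk k).centered_mul (h.integrable_id k) (h.mean k)
    · refine FreeOf.centered_mul (η := fun y => y ^ 2 - 1)
        (g := fun x => 1 / 2 * kerSum t (fun u => a k u ^ 2) S x) (fun x y => ?_)
        (h.integrable_sq_sub k) (h.integral_sq_sub k)
      simp only [freeOf_kerSum hk _ x y]
    · refine FreeOf.centered_mul (η := fun y => t k y - 1)
        (g := fun x => 1 / 2 * sqPart a S k x) (fun x y => ?_)
        (h.integrable_kernel_sub k) (h.integral_kernel_sub k)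
      simp only [freeOf_sqPart hk _ x y]

theorem lpLe_linPart (h : KernelMoments ν t B) (w : ι) (S : Finset ι) :
    LpLe (Measure.pi ν) (8 : ℕ) (linPart a S w) (7 * B * √(rowSq a w)) := by
  have h1 := (h.isTelescope_linPart (a := a) w).lpLe (n := 8) (Or.inr rfl) (c := 0)
    (b := fun k => B * |a w k|)
    (by simpa using (LpLe.const 0).of_eq fun x => by simp [linPart])
    (fun k S _ => FreeOf.lpLe_mul (η := fun y => y) (g := fun _ => a w k) (fun _ _ => rfl)
      (by norm_num) (h.lpLe_id k) (LpLe.const _)) S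
  refine h1.mono ?_
  have hB := h.nonneg
  -- The `7` comes from `40 ≤ 7²`.
  refine Real.sqrt_le_iff.2 ⟨by positivity, ?_⟩
  rw [mul_pow, Real.sq_sqrt (rowSq_nonneg a w)]
  have h2 : ∑ k ∈ S, (B * |a w k|) ^ 2 ≤ B ^ 2 * rowSq a w := by
    rw [rowSq, Finset.mul_sum]
    simp only [mul_pow, sq_abs]
    exact Finset.sum_le_sum_of_subset_of_nonneg (Finset.subset_univ S)
      fun _ _ _ => by positivity
  have h3 : 0 ≤ B ^ 2 * rowSq a w := mul_nonneg (sq_nonneg B) (rowSq_nonneg a w)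
  linarith

theorem lpLe_kerSum (h : KernelMoments ν t B) (b : ι → ℝ) (S : Finset ι) :
    LpLe (Measure.pi ν) (4 : ℕ) (kerSum t b S)
      (√((∑ u, b u) ^ 2 + 160 * B ^ 2 * ∑ u, b u ^ 2)) := by
  have h1 := (h.isTelescope_kerSum b).lpLe (n := 4) (Or.inl rfl) (c := |∑ u, b u|)
    (b := fun k => 2 * B * |b k|)
    ((LpLe.const _).of_eq fun x => by simp [kerSum])
    (fun k S _ => FreeOf.lpLe_mul (η := fun y => t k y - 1) (g := fun _ => b k) (fun _ _ => rfl)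
      (by norm_num) (h.lpLe_kernel_sub_four k) (LpLe.const _)) S
  refine h1.mono (Real.sqrt_le_sqrt ?_)
  rw [sq_abs]
  have h2 : ∑ k ∈ S, (2 * B * |b k|) ^ 2 ≤ 4 * B ^ 2 * ∑ u, b u ^ 2 := by
    rw [Finset.mul_sum]
    simp only [mul_pow, sq_abs]
    refine (Finset.sum_le_sum_of_subset_of_nonneg (Finset.subset_univ S)
      fun _ _ _ => by positivity).trans (le_of_eq ?_)
    exact Finset.sum_congr rfl fun _ _ => by ring
  linarith

theorem lpLe_biPart (h : KernelMoments ν t B) (hdiag : ∀ u, a u u = 0) (w : ι) (S : Finset ι) :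
    LpLe (Measure.pi ν) (4 : ℕ) (biPart a t S w) (biBound a B w) := by
  have h1 := (h.isTelescope_biPart hdiag w).lpLe (n := 4) (Or.inl rfl) (c := 0)
    (b := fun k => B * √((∑ u, a w u * a u k) ^ 2 + 160 * B ^ 2 * ∑ u, (a w u * a u k) ^ 2) +
      2 * B * (|a w k| * (7 * B * √(rowSq a k))))
    (by simpa using (LpLe.const 0).of_eq fun x => by simp [biPart, linPart])
    (fun k S hk => by
      refine LpLe.add ?_ ?_ (by norm_num)
      · exact FreeOf.lpLe_mul (freeOf_kerSum hk _) (by norm_num) (h.lpLe_id_four k)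
          (h.lpLe_kerSum _ S)
      · refine FreeOf.lpLe_mul (η := fun y => t k y - 1)
          (g := fun x => a w k * linPart a S k x) (fun x y => ?_) (by norm_num)
          (h.lpLe_kernel_sub_four k)
          (((h.lpLe_linPart k S).exponent_mono (by norm_num)).const_mul _)
        simp only [freeOf_linPart hk k x y]) S
  refine h1.mono (Real.sqrt_le_sqrt ?_)
  rw [zero_pow two_ne_zero, zero_add, Finset.mul_sum]
  refine (Finset.sum_le_sum_of_subset_of_nonneg (Finset.subset_univ S)
    fun _ _ _ => by positivity).trans (Finset.sum_le_sum fun k _ => ?_)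
  have hs : 0 ≤ (∑ u, a w u * a u k) ^ 2 + 160 * B ^ 2 * ∑ u, (a w u * a u k) ^ 2 := by
    have : 0 ≤ ∑ u, (a w u * a u k) ^ 2 := Finset.sum_nonneg fun _ _ => sq_nonneg _
    positivity
  set s := (∑ u, a w u * a u k) ^ 2 + 160 * B ^ 2 * ∑ u, (a w u * a u k) ^ 2
  have e1 : (B * √s) ^ 2 = B ^ 2 * s := by rw [mul_pow, Real.sq_sqrt hs]
  have e2 : (2 * B * (|a w k| * (7 * B * √(rowSq a k)))) ^ 2 =
      196 * B ^ 4 * (a w k ^ 2 * rowSq a k) := by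
    simp only [mul_pow, sq_abs, Real.sq_sqrt (rowSq_nonneg a k)]
    ring
  -- Splitting the square costs a factor `2`, hence `80 = 2 · 40` in `biBound`; the `196` there is
  -- `(2 · 7)²`.
  have := add_sq_le (a := B * √s) (b := 2 * B * (|a w k| * (7 * B * √(rowSq a k))))
  rw [e1, e2] at this
  linarith

theorem lpLe_quadPart (h : KernelMoments ν t B) (hsymm : ∀ u v, a u v = a v u)
    (hdiag : ∀ u, a u u = 0)
    (S : Finset ι) :
    LpLe (Measure.pi ν) (8 : ℕ) (quadPart a S) (√(1960 * B ^ 4 * ∑ k, rowSq a k)) := by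
  have h1 := (h.isTelescope_quadPart hsymm hdiag).lpLe (n := 8) (Or.inr rfl) (c := 0)
    (b := fun k => B * (7 * B * √(rowSq a k)))
    (by simpa using (LpLe.const 0).of_eq fun x => by simp [quadPart])
    (fun k S hk => FreeOf.lpLe_mul (freeOf_linPart hk _) (by norm_num) (h.lpLe_id k)
      (h.lpLe_linPart _ S)) S
  -- `1960 = 40 · 7²`.
  refine h1.mono (Real.sqrt_le_sqrt ?_)
  rw [zero_pow two_ne_zero, zero_add, Finset.mul_sum, Finset.mul_sum]
  refine (Finset.sum_le_sum_of_subset_of_nonneg (Finset.subset_univ S)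
    fun _ _ _ => by positivity).trans (Finset.sum_le_sum fun k _ => ?_)
  simp only [mul_pow, Real.sq_sqrt (rowSq_nonneg a k)]
  linarith

theorem lpLe_linPart_sq (h : KernelMoments ν t B) (w : ι) (S : Finset ι) :
    LpLe (Measure.pi ν) (4 : ℕ) (fun x => linPart a S w x ^ 2) (49 * B ^ 2 * rowSq a w) := by
  refine (((h.lpLe_linPart w S).mul (h.lpLe_linPart w S)).mono (le_of_eq ?_)).of_eq
    fun x => (pow_two _).symm
  have := Real.mul_self_sqrt (rowSq_nonneg a w)
  linear_combination 49 * B ^ 2 * this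

theorem lpLe_sqPart (h : KernelMoments ν t B) (w : ι) (S : Finset ι) :
    LpLe (Measure.pi ν) (4 : ℕ) (sqPart a S w) (50 * B ^ 2 * rowSq a w) := by
  refine (((h.lpLe_linPart_sq w S).add (LpLe.const _) (by norm_num)).mono ?_)
  have h1 : ∑ v ∈ S, a w v ^ 2 ≤ ∑ v, a w v ^ 2 :=
    Finset.sum_le_sum_of_subset_of_nonneg (Finset.subset_univ S) fun _ _ _ => sq_nonneg _
  have h2 : 0 ≤ ∑ v ∈ S, a w v ^ 2 := Finset.sum_nonneg fun _ _ => sq_nonneg _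
  have h3 := rowSq_nonneg a w
  rw [abs_of_nonneg (by linarith)]
  have h4 : rowSq a w ≤ B ^ 2 * rowSq a w :=
    le_mul_of_one_le_left h3 (by nlinarith [h.one_le])
  have h5 : ∑ v, a w v ^ 2 = rowSq a w := rfl
  linarith

theorem lpLe_kerSum_sq (h : KernelMoments ν t B) (w : ι) (S : Finset ι) :
    LpLe (Measure.pi ν) (4 : ℕ) (kerSum t (fun u => a w u ^ 2) S) (13 * B * rowSq a w) := by
  refine (h.lpLe_kerSum (fun u => a w u ^ 2) S).mono ?_
  have hr := rowSq_nonneg a w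
  have hB := h.one_le
  -- Nonnegative weights satisfy `∑ b² ≤ (∑ b)²`, so `1 + 160 B² ≤ 161 B² ≤ (13 B)²` suffices.
  refine Real.sqrt_le_iff.2 ⟨by positivity, ?_⟩
  have h1 : ∑ u, (a w u ^ 2) ^ 2 ≤ rowSq a w ^ 2 :=
    Finset.sum_sq_le_sq_sum_of_nonneg fun _ _ => sq_nonneg _
  have h2 : ∑ u, a w u ^ 2 = rowSq a w := rfl
  have h3 : rowSq a w ^ 2 ≤ B ^ 2 * rowSq a w ^ 2 :=
    le_mul_of_one_le_left (sq_nonneg _) (by nlinarith)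
  have h4 : B ^ 2 * ∑ u, (a w u ^ 2) ^ 2 ≤ B ^ 2 * rowSq a w ^ 2 := by gcongr
  rw [h2]
  nlinarith

/-- The concentration estimate for `Θ`. The telescope of `Θ` minus its mean starts at zero, so only
the increments contribute, and their squared norms sum to a multiple of `fourthSum`. -/
theorem lpLe_thetaPart (h : KernelMoments ν t B) (hsymm : ∀ u v, a u v = a v u)
    (hdiag : ∀ u, a u u = 0)
    (S : Finset ι) :
    LpLe (Measure.pi ν) (4 : ℕ) (fun x => thetaPart a t S x - 1 / 2 * ∑ k, rowSq a k)
      (√(2600000 * B ^ 6 * fourthSum a)) := by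
  have hB := h.one_le
  have h1 := (h.isTelescope_thetaPart hsymm hdiag (1 / 2 * ∑ k, rowSq a k)).lpLe (n := 4)
    (Or.inl rfl) (c := 0)
    (b := fun k => B * biBound a B k + 63 * B ^ 3 * rowSq a k)
    (by simpa using (LpLe.const 0).of_eq fun x => by simp [thetaPart, sqPart, linPart, rowSq])
    (fun k S hk => by
      have hb1 := FreeOf.lpLe_mul (freeOf_biPart hk _) (by norm_num) (h.lpLe_id_four k)
          (h.lpLe_biPart hdiag k S)
      have hb2 := FreeOf.lpLe_mul (k := k) (η := fun y => y ^ 2 - 1)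
          (g := fun x => 1 / 2 * kerSum t (fun u => a k u ^ 2) S x)
          (fun x y => by simp only [freeOf_kerSum hk _ x y]) (by norm_num)
          (h.lpLe_sq_sub k) ((h.lpLe_kerSum_sq k S).const_mul (1 / 2))
      have hb3 := FreeOf.lpLe_mul (k := k) (η := fun y => t k y - 1)
          (g := fun x => 1 / 2 * sqPart a S k x)
          (fun x y => by simp only [freeOf_sqPart hk _ x y]) (by norm_num)
          (h.lpLe_kernel_sub_four k) ((h.lpLe_sqPart k S).const_mul (1 / 2))
      -- `63 = 13 + 50`: the factors `½` cancel the `2` in the norms of `y² - 1` and `t - 1`.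
      refine ((hb1.add hb2 (by norm_num)).add hb3 (by norm_num)).mono (le_of_eq ?_)
      rw [abs_of_pos (by norm_num : (0 : ℝ) < 1 / 2)]
      ring) S
  refine h1.mono (Real.sqrt_le_sqrt ?_)
  rw [zero_pow two_ne_zero, zero_add]
  have h2 : ∀ k, (B * biBound a B k + 63 * B ^ 3 * rowSq a k) ^ 2 ≤
      2 * B ^ 2 * biBound a B k ^ 2 + 7938 * B ^ 6 * rowSq a k ^ 2 := by
    intro k
    have := add_sq_le (a := B * biBound a B k) (b := 63 * B ^ 3 * rowSq a k)
    linarith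
  have h3 : ∑ k ∈ S, (B * biBound a B k + 63 * B ^ 3 * rowSq a k) ^ 2 ≤
      ∑ k, (2 * B ^ 2 * biBound a B k ^ 2 + 7938 * B ^ 6 * rowSq a k ^ 2) :=
    (Finset.sum_le_sum_of_subset_of_nonneg (Finset.subset_univ S)
      fun _ _ _ => by positivity).trans (Finset.sum_le_sum fun k _ => h2 k)
  rw [Finset.sum_add_distrib, ← Finset.mul_sum, ← Finset.mul_sum] at h3
  have h4 : 2 * B ^ 2 * ∑ k, biBound a B k ^ 2 ≤ 2 * B ^ 2 * (28480 * B ^ 4 * fourthSum a) := by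
    gcongr
    exact sum_biBound_sq_le hsymm hB
  have h5 : 7938 * B ^ 6 * ∑ k, rowSq a k ^ 2 ≤ 7938 * B ^ 6 * fourthSum a := by
    gcongr
    exact sum_rowSq_sq_le a
  have h6 : 0 ≤ B ^ 6 * fourthSum a := mul_nonneg (by positivity) (fourthSum_nonneg a)
  -- `40 · (2 · 28480 + 7938) = 2595920`.
  nlinarith

theorem integral_thetaPart (h : KernelMoments ν t B) (hsymm : ∀ u v, a u v = a v u)
    (hdiag : ∀ u, a u u = 0)
    (S : Finset ι) :
    Integrable (thetaPart a t S) (Measure.pi ν) ∧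
      ∫ x, thetaPart a t S x ∂(Measure.pi ν) = 1 / 2 * ∑ k, rowSq a k := by
  have hint : ∀ S, Integrable (thetaPart a t S) (Measure.pi ν) := fun S => by
    have := ((h.lpLe_thetaPart hsymm hdiag S).memLp.integrable (by norm_num)).add
      (integrable_const (1 / 2 * ∑ k, rowSq a k))
    simpa [Pi.add_def] using this
  have hT := h.isTelescope_thetaPart hsymm hdiag (a := a) 0
  simp only [sub_zero] at hT
  refine ⟨hint S, ?_⟩
  have h1 := (hT.integral_eq (hint ∅) (fun k S hk => ?_) S).2
  · refine h1.trans ?_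
    simp [thetaPart, sqPart, linPart, rowSq]
  · refine ((hint (insert k S)).sub (hint S)).congr (ae_of_all _ fun x => ?_)
    have := hT.insert_eq k S hk x
    simp only [Pi.sub_apply]
    linarith

theorem integral_id_mul_sq (h : KernelMoments ν t B) {k : ι} {g : (ι → ℝ) → ℝ}
    (hg : FreeOf k g) {b : ℝ}
    (hb : LpLe (Measure.pi ν) (8 : ℕ) g b) :
    MemLp (fun x => x k * g x) 2 (Measure.pi ν) ∧
      ∫ x, (x k * g x) ^ 2 ∂(Measure.pi ν) = ∫ x, g x ^ 2 ∂(Measure.pi ν) := by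
  have hm : MemLp (fun x => x k * g x) 2 (Measure.pi ν) :=
    (hg.lpLe_mul (by norm_num) (h.lpLe_id k) hb).memLp.mono_exponent (by norm_num)
  refine ⟨hm, ?_⟩
  rw [← integral_update hm.integrable_sq k]
  simp [hg _ _, mul_pow, integral_mul_const, h.second_moment]

theorem integral_linPart_sq (h : KernelMoments ν t B) (w : ι) (S : Finset ι) :
    ∫ x, linPart a S w x ^ 2 ∂(Measure.pi ν) = ∑ v ∈ S, a w v ^ 2 := by
  have hD : ∀ k, MemLp (fun x : ι → ℝ => x k * a w k) 2 (Measure.pi ν) ∧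
      ∫ x, (x k * a w k) ^ 2 ∂(Measure.pi ν) = ∫ x, a w k ^ 2 ∂(Measure.pi ν) := fun k =>
    h.integral_id_mul_sq (g := fun _ => a w k) (fun _ _ => rfl) (LpLe.const _)
  refine ((h.isTelescope_linPart (a := a) w).integral_sq_eq (v := fun S => ∑ v ∈ S, a w v ^ 2)
    (h.lpLe_linPart w ∅ |>.memLp.mono_exponent (by norm_num)) (fun k S hk => (hD k).1) ?_ ?_ S).2
  · simp [linPart]
  · intro k S hk
    rw [(hD k).2, Finset.sum_insert hk]
    simp [add_comm]

/-- The second moment of the quadratic form coincides with the mean of `Θ`, so normalizing the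
variance also normalizes `Θ`. -/
theorem integral_quadPart (h : KernelMoments ν t B) (hsymm : ∀ u v, a u v = a v u)
    (hdiag : ∀ u, a u u = 0) :
    ∫ x, quadPart a Finset.univ x ∂(Measure.pi ν) = 0 ∧
      ∫ x, quadPart a Finset.univ x ^ 2 ∂(Measure.pi ν) = 1 / 2 * ∑ k, rowSq a k := by
  have hT := h.isTelescope_quadPart hsymm hdiag
  have hD : ∀ k S, k ∉ S → MemLp (fun x : ι → ℝ => x k * linPart a S k x) 2 (Measure.pi ν) ∧
      ∫ x, (x k * linPart a S k x) ^ 2 ∂(Measure.pi ν) =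
        ∫ x, linPart a S k x ^ 2 ∂(Measure.pi ν) := fun k S hk =>
    h.integral_id_mul_sq (freeOf_linPart hk k) (h.lpLe_linPart k S)
  have h0 : MemLp (quadPart a ∅) 2 (Measure.pi ν) :=
    (h.lpLe_quadPart hsymm hdiag ∅).memLp.mono_exponent (by norm_num)
  constructor
  · refine (hT.integral_eq (h0.integrable (by norm_num))
      (fun k S hk => (hD k S hk).1.integrable (by norm_num)) _).2.trans ?_
    simp [quadPart]
  · refine (hT.integral_sq_eq (v := fun S => 1 / 2 * ∑ u ∈ S, ∑ v ∈ S, a u v ^ 2) h0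
      (fun k S hk => (hD k S hk).1) ?_ ?_ Finset.univ).2
    · simp [quadPart]
    · intro k S hk
      rw [(hD k S hk).2, h.integral_linPart_sq]
      simp only [Finset.sum_insert hk, Finset.sum_add_distrib, hdiag]
      have : ∑ u ∈ S, a u k ^ 2 = ∑ v ∈ S, a k v ^ 2 :=
        Finset.sum_congr rfl fun u _ => by rw [hsymm]
      rw [this]
      ring

end KernelMoments

/-- The derivative in direction `k` of `(1/2) ∑_u t_u(x_u) (∑_v a_{uv} x_v)²`. -/
noncomputable def gradTheta (a : ι → ι → ℝ) (t dt : ι → ℝ → ℝ) (k : ι) (x : ι → ℝ) : ℝ :=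
  1 / 2 * (dt k (x k) * linPart a Finset.univ k x ^ 2) + biPart a t Finset.univ k x

/-- A bound for the `L^4` norm of `gradTheta`. -/
noncomputable def gradBound (a : ι → ι → ℝ) (B : ℝ) (k : ι) : ℝ :=
  25 * B ^ 3 * rowSq a k + biBound a B k

/-- The derivative of the kernel enters only through `dt k (x k)`, and its cofactor does not depend
on `x k`; hence the norms multiply, and the rest is `biPart`. -/
theorem KernelMoments.lpLe_gradTheta {B : ℝ} (h : KernelMoments ν t B) {dt : ι → ℝ → ℝ}
    (hdt : ∀ u, LpLe (ν u) (8 : ℕ) (dt u) B) (hdiag : ∀ u, a u u = 0) (k : ι) :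
    LpLe (Measure.pi ν) (4 : ℕ) (gradTheta a t dt k) (gradBound a B k) := by
  have h1 := FreeOf.lpLe_mul (k := k) (η := dt k) (g := fun x => linPart a Finset.univ k x ^ 2)
    (fun x y => by simp only [freeOf_linPart_self hdiag Finset.univ k x y]) (by norm_num)
    ((hdt k).exponent_mono (q := (4 : ℕ)) (by norm_num)) (h.lpLe_linPart_sq k Finset.univ)
  refine ((h1.const_mul (1 / 2)).add (h.lpLe_biPart hdiag k Finset.univ) (by norm_num)).mono ?_
  rw [gradBound, abs_of_pos (by norm_num : (0 : ℝ) < 1 / 2)]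
  have := rowSq_nonneg a k
  have hB := h.nonneg
  have : 0 ≤ B ^ 3 * rowSq a k := by positivity
  linarith

theorem sum_gradBound_sq_le (hsymm : ∀ u v, a u v = a v u) {B : ℝ} (hB : 1 ≤ B) :
    ∑ k, gradBound a B k ^ 2 ≤ 60000 * B ^ 6 * fourthSum a := by
  have h2 : ∀ k, gradBound a B k ^ 2 ≤ 1250 * B ^ 6 * rowSq a k ^ 2 + 2 * biBound a B k ^ 2 := by
    intro k
    have := add_sq_le (a := 25 * B ^ 3 * rowSq a k) (b := biBound a B k)
    rw [gradBound]
    linarith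
  refine (Finset.sum_le_sum fun k _ => h2 k).trans ?_
  rw [Finset.sum_add_distrib, ← Finset.mul_sum, ← Finset.mul_sum]
  have h4 := sum_biBound_sq_le hsymm hB
  have h5 : 1250 * B ^ 6 * ∑ k, rowSq a k ^ 2 ≤ 1250 * B ^ 6 * fourthSum a := by
    gcongr
    exact sum_rowSq_sq_le a
  have h6 : B ^ 4 * fourthSum a ≤ B ^ 6 * fourthSum a :=
    mul_le_mul_of_nonneg_right (pow_le_pow_right₀ hB (by norm_num)) (fourthSum_nonneg a)
  have h7 : 0 ≤ B ^ 6 * fourthSum a := mul_nonneg (by positivity) (fourthSum_nonneg a)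
  nlinarith

end Parts

/-! ### Densities from integration by parts -/

theorem isFiniteMeasureOnCompacts_withDensity_ofReal {q : ℝ → ℝ} {M : ℝ} (hM : ∀ x, |q x| ≤ M) :
    IsFiniteMeasureOnCompacts (volume.withDensity fun x => ENNReal.ofReal (q x)) := by
  refine ⟨fun K hK => ?_⟩
  rw [withDensity_apply _ hK.measurableSet]
  calc ∫⁻ x in K, ENNReal.ofReal (q x) ≤ ∫⁻ x in K, ENNReal.ofReal M :=
        lintegral_mono fun x => ENNReal.ofReal_le_ofReal ((le_abs_self _).trans (hM x))
    _ = ENNReal.ofReal M * volume K := by simp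
    _ < ∞ := ENNReal.mul_lt_top ENNReal.ofReal_lt_top hK.measure_lt_top

/-- A probability measure which integrates test functions like a bounded function `q` has
density `q`. -/
theorem eq_withDensity_of_forall_integral_eq {ν : Measure ℝ} [IsProbabilityMeasure ν] {q : ℝ → ℝ}
    (hq : Measurable q) {M : ℝ} (hM : ∀ x, |q x| ≤ M)
    (h : ∀ ψ : ℝ → ℝ, Continuous ψ → HasCompactSupport ψ → ∫ x, ψ x ∂ν = ∫ x, ψ x * q x) :
    (∀ᵐ x : ℝ, 0 ≤ q x) ∧ ν = volume.withDensity fun x => ENNReal.ofReal (q x) := by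
  have hfin1 := isFiniteMeasureOnCompacts_withDensity_ofReal hM
  have hfin2 := isFiniteMeasureOnCompacts_withDensity_ofReal (q := fun x => -q x) (M := M)
    (fun x => by rw [abs_neg]; exact hM x)
  have hq1 : Measurable fun x => ENNReal.ofReal (q x) := hq.ennreal_ofReal
  have hq2 : Measurable fun x => ENNReal.ofReal (-q x) := hq.neg.ennreal_ofReal
  have heq : ν + volume.withDensity (fun x => ENNReal.ofReal (-q x)) =
      volume.withDensity fun x => ENNReal.ofReal (q x) := by
    have hfin3 : IsFiniteMeasureOnCompacts
        (ν + volume.withDensity (fun x => ENNReal.ofReal (-q x))) :=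
      ⟨fun K hK => by
        rw [Measure.add_apply]
        exact ENNReal.add_lt_top.2 ⟨measure_lt_top _ _, hK.measure_lt_top⟩⟩
    refine Measure.ext_of_integral_eq_on_compactlySupported fun f => ?_
    have hf : Continuous f := f.continuous
    have hfc : HasCompactSupport f := f.hasCompactSupport
    rw [integral_add_measure (hf.integrable_of_hasCompactSupport hfc)
      (hf.integrable_of_hasCompactSupport hfc), h f hf hfc,
      integral_withDensity_eq_integral_toReal_smul hq1 (ae_of_all _ fun _ => ENNReal.ofReal_lt_top),
      integral_withDensity_eq_integral_toReal_smul hq2 (ae_of_all _ fun _ => ENNReal.ofReal_lt_top)]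
    have hi0 : Integrable f := hf.integrable_of_hasCompactSupport hfc
    have hi1 : Integrable fun x => f x * q x :=
      hi0.mul_bdd (c := M) hq.aestronglyMeasurable (ae_of_all _ hM)
    have hi2 : Integrable fun x => (ENNReal.ofReal (-q x)).toReal • f x := by
      simp only [smul_eq_mul]
      refine hi0.bdd_mul (c := M) hq2.ennreal_toReal.aestronglyMeasurable (ae_of_all _ fun x => ?_)
      rw [ENNReal.toReal_ofReal']
      have := hM x
      rw [Real.norm_eq_abs, abs_of_nonneg (le_max_right _ _)]
      exact max_le ((neg_le_abs _).trans this) ((abs_nonneg _).trans this)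
    rw [← integral_add hi1 hi2]
    refine integral_congr_ae (ae_of_all _ fun x => ?_)
    simp only [ENNReal.toReal_ofReal', smul_eq_mul]
    rcases le_total 0 (q x) with hx | hx
    · rw [max_eq_left hx, max_eq_right (by linarith)]
      ring
    · rw [max_eq_right hx, max_eq_left (by linarith)]
      ring
  have hnn : ∀ᵐ x : ℝ, 0 ≤ q x := by
    have hN : MeasurableSet {x | q x < 0} := measurableSet_lt hq measurable_const
    have h1 : (volume.withDensity fun x => ENNReal.ofReal (q x)) {x | q x < 0} = 0 := by
      rw [withDensity_apply _ hN, setLIntegral_eq_zero_iff hN hq1]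
      refine ae_of_all _ fun x hx => ?_
      exact ENNReal.ofReal_of_nonpos (le_of_lt hx)
    rw [← heq, Measure.add_apply, add_eq_zero, withDensity_apply _ hN,
      setLIntegral_eq_zero_iff hN hq2] at h1
    filter_upwards [h1.2] with x hx
    by_contra hneg
    have := hx (not_le.1 hneg)
    simp only [ENNReal.ofReal_eq_zero] at this
    linarith
  refine ⟨hnn, ?_⟩
  have hz : volume.withDensity (fun x => ENNReal.ofReal (-q x)) = 0 := by
    rw [withDensity_congr_ae (g := 0), withDensity_zero]
    filter_upwards [hnn] with x hx
    simp [hx]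
  rw [← heq, hz, add_zero]

variable {Ω : Type*} [MeasurableSpace Ω] {P : Measure Ω} [IsProbabilityMeasure P]

/-- If `E[φ'(F)] = E[φ(F) S]` for test functions `φ`, then the law of `F` has the density
`x ↦ E[S 1_{F ≥ x}]`. -/
theorem integral_comp_eq_integral_mul_tail {F S : Ω → ℝ} (hF : Measurable F)
    (hS : Integrable S P)
    (hibp : ∀ φ ψ : ℝ → ℝ, (∀ x, HasDerivAt φ (ψ x) x) → Continuous ψ →
      (∃ M, ∀ x, |φ x| ≤ M ∧ |ψ x| ≤ M) →
      ∫ ω, ψ (F ω) ∂P = ∫ ω, φ (F ω) * S ω ∂P)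
    {ψ : ℝ → ℝ} (hψ : Continuous ψ) (hψc : HasCompactSupport ψ) :
    ∫ ω, ψ (F ω) ∂P = ∫ x, ψ x * ∫ ω in F ⁻¹' Ici x, S ω ∂P := by
  have hi : Integrable ψ := hψ.integrable_of_hasCompactSupport hψc
  obtain ⟨M, hM⟩ := hψ.bounded_above_of_compact_support hψc
  have hIic : ∀ x, ∫ y in Iic x, ψ y = (∫ y, ψ y) - ∫ y in Ioi x, ψ y := by
    intro x
    have := integral_add_compl (s := Iic x) measurableSet_Iic hi
    rw [compl_Iic] at this
    linarith
  -- The primitive starting at `-∞` is bounded and satisfies `φ(F) = ∫ ψ(y) 1_{y ≤ F} dy`; Fubini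
  -- then exchanges `y` with the sample point.
  have hφ : ∀ x, HasDerivAt (fun x => ∫ y in Iic x, ψ y) (ψ x) x := by
    intro x
    simp only [hIic]
    have := (hasDerivAt_integral_Ioi_of_integrable hi hψ.continuousAt (x := x)).const_sub
      (∫ y, ψ y)
    simpa using this
  have hbound : ∀ x, |∫ y in Iic x, ψ y| ≤ ∫ y, |ψ y| := by
    intro x
    refine (abs_integral_le_integral_abs).trans ?_
    exact setIntegral_le_integral hi.abs (ae_of_all _ fun _ => abs_nonneg _)
  rw [hibp _ ψ hφ hψ ⟨max M (∫ y, |ψ y|), fun x =>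
    ⟨(hbound x).trans (le_max_right _ _), (hM x).trans (le_max_left _ _)⟩⟩]
  have hset : MeasurableSet {z : Ω × ℝ | z.2 ≤ F z.1} :=
    measurableSet_le measurable_snd (hF.comp measurable_fst)
  have hprod : Integrable (fun z : Ω × ℝ => {z : Ω × ℝ | z.2 ≤ F z.1}.indicator
      (fun z => S z.1 * ψ z.2) z) (P.prod volume) := (hS.mul_prod hi).indicator hset
  have e1 : ∀ ω, (∫ y in Iic (F ω), ψ y) * S ω =
      ∫ y, {z : Ω × ℝ | z.2 ≤ F z.1}.indicator (fun z => S z.1 * ψ z.2) (ω, y) := by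
    intro ω
    rw [← integral_indicator measurableSet_Iic, ← integral_mul_const]
    refine integral_congr_ae (ae_of_all _ fun y => ?_)
    by_cases hy : y ≤ F ω
    · simp [indicator, hy, mul_comm]
    · simp [indicator, hy]
  have e2 : ∀ y, ψ y * ∫ ω in F ⁻¹' Ici y, S ω ∂P =
      ∫ ω, {z : Ω × ℝ | z.2 ≤ F z.1}.indicator (fun z => S z.1 * ψ z.2) (ω, y) ∂P := by
    intro y
    rw [← integral_indicator (hF measurableSet_Ici), ← integral_const_mul]
    refine integral_congr_ae (ae_of_all _ fun ω => ?_)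
    by_cases hy : y ≤ F ω
    · simp [indicator, hy, mul_comm]
    · simp [indicator, hy]
  simp only [e1, e2]
  exact integral_integral_swap hprod

/-- Let `s(F) = E[S | F]`. The density is `q(x) = E[S 1_{F ≥ x}] = ∫_x^∞ s q`, so `q' = -s q` and
the score is `-s`. The Fisher distance is thus `E[(F - s(F))²]`, and `F - s(F)` is the conditional
expectation of `F - S`. -/
theorem fisherDistance_map_le {F S : Ω → ℝ} (hF : Measurable F) (hS : Integrable S P)
    (hFS : MemLp (fun ω => F ω - S ω) 2 P) (hmean : ∫ ω, F ω ∂P = 0)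
    (hvar : variance id (P.map F) = 1)
    (hibp : ∀ φ ψ : ℝ → ℝ, (∀ x, HasDerivAt φ (ψ x) x) → Continuous ψ →
      (∃ M, ∀ x, |φ x| ≤ M ∧ |ψ x| ≤ M) →
      ∫ ω, ψ (F ω) ∂P = ∫ ω, φ (F ω) * S ω ∂P) :
    fisherDistance (P.map F) ≤ ∫⁻ ω, ‖F ω - S ω‖ₑ ^ 2 ∂P := by
  have hprob : IsProbabilityMeasure (P.map F) := Measure.isProbabilityMeasure_map hF.aemeasurable
  have hmle := hF.comap_le
  obtain ⟨s, hs, hsF⟩ := (stronglyMeasurable_condExp (m := Real.measurableSpace.comap F) (μ := P)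
    (f := S)).measurable.exists_eq_measurable_comp
  have hsF' : ∀ ω, (P[S|Real.measurableSpace.comap F]) ω = s (F ω) := fun ω => congrFun hsF ω
  have hFi : Integrable F P := by
    have := (hFS.integrable (by norm_num)).add hS
    refine this.congr (ae_of_all _ fun ω => ?_)
    simp
  have hsi : Integrable s (P.map F) := by
    rw [integrable_map_measure hs.aestronglyMeasurable hF.aemeasurable, ← hsF]
    exact integrable_condExp
  set q : ℝ → ℝ := fun x => ∫ ω in F ⁻¹' Ici x, S ω ∂P with hq
  have hqs : ∀ x, q x = ∫ y in Ici x, s y ∂(P.map F) := by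
    intro x
    rw [setIntegral_map measurableSet_Ici hs.aestronglyMeasurable hF.aemeasurable]
    simp only [← hsF']
    rw [setIntegral_condExp hmle hS ⟨Ici x, measurableSet_Ici, rfl⟩]
  have hqM : ∀ x, |q x| ≤ ∫ ω, |S ω| ∂P := fun x =>
    abs_integral_le_integral_abs.trans
      (setIntegral_le_integral hS.abs (ae_of_all _ fun _ => abs_nonneg _))
  have hqm : Measurable q := by
    have hset : MeasurableSet {z : ℝ × ℝ | z.1 ≤ z.2} :=
      measurableSet_le measurable_fst measurable_snd
    have h1 : Measurable fun z : ℝ × ℝ => {z : ℝ × ℝ | z.1 ≤ z.2}.indicator (fun z => s z.2) z :=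
      (hs.comp measurable_snd).indicator hset
    have h2 := (h1.stronglyMeasurable.integral_prod_right' (ν := P.map F)).measurable
    convert h2 using 2 with x
    rw [hqs x, ← integral_indicator measurableSet_Ici]
    refine integral_congr_ae (ae_of_all _ fun y => ?_)
    simp [indicator]
  obtain ⟨hnn, hlaw⟩ := eq_withDensity_of_forall_integral_eq (ν := P.map F) hqm hqM
    fun ψ hψ hψc => by
      rw [integral_map hF.aemeasurable hψ.aestronglyMeasurable]
      exact integral_comp_eq_integral_mul_tail hF hS hibp hψ hψc
  have hqr : Measurable fun x => ENNReal.ofReal (q x) := hqm.ennreal_ofReal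
  have hlt : ∀ᵐ x : ℝ, ENNReal.ofReal (q x) < ∞ := ae_of_all _ fun _ => ENNReal.ofReal_lt_top
  have hsq : Integrable fun x => s x * q x := by
    have h1 : Integrable s (volume.withDensity fun x => ENNReal.ofReal (q x)) := by
      rw [← hlaw]; exact hsi
    rw [integrable_withDensity_iff_integrable_smul' hqr hlt] at h1
    refine h1.congr ?_
    filter_upwards [hnn] with x hx
    rw [ENNReal.toReal_ofReal hx, smul_eq_mul, mul_comm]
  -- Feeding the density just found back into the definition of `q` shows that `q` is itself an
  -- integral, hence absolutely continuous.
  have htail : ∀ x, q x = ∫ y in Ioi x, s y * q y := by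
    intro x
    rw [hqs x, hlaw, restrict_withDensity measurableSet_Ici,
      integral_withDensity_eq_integral_toReal_smul hqr (ae_restrict_of_ae hlt),
      integral_Ici_eq_integral_Ioi]
    refine integral_congr_ae (ae_restrict_of_ae ?_)
    filter_upwards [hnn] with y hy
    rw [ENNReal.toReal_ofReal hy, smul_eq_mul, mul_comm]
  have hqc : Continuous q := by
    rw [funext htail]
    exact continuous_integral_Ioi_of_integrable hsq
  -- Continuity upgrades nonnegativity from almost everywhere to everywhere.
  have hq0 : ∀ x, 0 ≤ q x := by
    have hopen : IsOpen {x | q x < 0} := isOpen_lt hqc continuous_const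
    have hnull : (volume : Measure ℝ) {x | q x < 0} = 0 := by
      have : {x | q x < 0} = {x | ¬ 0 ≤ q x} := by ext; simp
      rw [this]
      exact hnn
    have := (hopen.measure_eq_zero_iff volume).1 hnull
    intro x
    by_contra hx
    have hmem : x ∈ {x | q x < 0} := not_le.1 hx
    rw [this] at hmem
    exact hmem
  have hAC : IsACDensity (P.map F) q (fun x => -(s x * q x)) := by
    refine ⟨hlaw, hq0, hsq.neg.locallyIntegrable, fun a b => ?_⟩
    rw [intervalIntegral.integral_neg, ← intervalIntegral.integral_Ioi_sub_Ioi'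
      hsq.integrableOn hsq.integrableOn, ← htail, ← htail]
    ring
  have hmean' : ∫ y, y ∂(P.map F) = 0 := by
    rw [integral_map hF.aemeasurable (by fun_prop), hmean]
  have hpos : ∀ᵐ x ∂(P.map F), 0 < q x := by
    rw [hlaw, ae_withDensity_iff hqr]
    refine ae_of_all _ fun x hx => ?_
    simpa using hx
  calc fisherDistance (P.map F)
      ≤ ∫⁻ x, ENNReal.ofReal ((-(s x * q x) / q x +
          (x - ∫ y, y ∂(P.map F)) / variance id (P.map F)) ^ 2) ∂(P.map F) :=
        iInf_le_of_le q (iInf_le_of_le _ (iInf_le_of_le hAC le_rfl))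
    _ = ∫⁻ x, ‖x - s x‖ₑ ^ 2 ∂(P.map F) := by
        refine lintegral_congr_ae ?_
        filter_upwards [hpos] with x hx
        rw [hmean', hvar, Real.enorm_eq_ofReal_abs, ← ENNReal.ofReal_pow (abs_nonneg _), sq_abs]
        congr 2
        field_simp
        ring
    _ = ∫⁻ ω, ‖F ω - s (F ω)‖ₑ ^ 2 ∂P := lintegral_map (by fun_prop) hF
    _ = ∫⁻ ω, ‖(P[fun ω => F ω - S ω|Real.measurableSpace.comap F]) ω‖ₑ ^ 2 ∂P := by
        have h1 : P[fun ω => F ω - S ω|Real.measurableSpace.comap F] =ᵐ[P] P[F|Real.measurableSpace.comap F] - P[S|Real.measurableSpace.comap F] := condExp_sub hFi hS _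
        have h2 : P[F|Real.measurableSpace.comap F] = F := condExp_of_stronglyMeasurable hmle
          (comap_measurable F).stronglyMeasurable hFi
        refine lintegral_congr_ae ?_
        filter_upwards [h1] with ω hω
        rw [hω, Pi.sub_apply, h2, hsF']
    _ ≤ ∫⁻ ω, ‖F ω - S ω‖ₑ ^ 2 ∂P := by
        have key := eLpNorm_condExp_le_eLpNorm (m := Real.measurableSpace.comap F) (μ := P) (fun ω => F ω - S ω) (p := 2)
          (by norm_num)
        have := pow_le_pow_left₀ zero_le key 2
        have e : ∀ f : Ω → ℝ, eLpNorm f 2 P ^ 2 = ∫⁻ ω, ‖f ω‖ₑ ^ 2 ∂P := fun f => by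
          have := eLpNorm_nnreal_pow_eq_lintegral (f := f) (μ := P) (p := 2) two_ne_zero
          simpa using this
        rwa [e, e] at this

/-! ### Integration by parts for quadratic forms -/

section IntegrationByParts

variable {ι : Type*} [Fintype ι] [DecidableEq ι] {ν : ι → Measure ℝ}
  [∀ i, IsProbabilityMeasure (ν i)] {a : ι → ι → ℝ} {t dt : ι → ℝ → ℝ}

theorem linPart_univ_eq_erase (hdiag : ∀ u, a u u = 0) (k : ι) (x : ι → ℝ) :
    linPart a Finset.univ k x = linPart a (Finset.univ.erase k) k x := by
  have := linPart_insert (a := a) (Finset.notMem_erase k Finset.univ) k x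
  rwa [Finset.insert_erase (Finset.mem_univ k), hdiag, zero_mul, add_zero] at this

theorem sqPart_univ (u : ι)
    (x : ι → ℝ) : sqPart a Finset.univ u x = linPart a Finset.univ u x ^ 2 := by
  simp [sqPart]

theorem sqPart_erase (hdiag : ∀ u, a u u = 0) (k : ι) (x : ι → ℝ) :
    sqPart a (Finset.univ.erase k) k x = linPart a Finset.univ k x ^ 2 := by
  rw [sqPart, linPart_univ_eq_erase hdiag, ← Finset.add_sum_erase _ _ (Finset.mem_univ k), hdiag]
  ring

theorem thetaPart_univ (x : ι → ℝ) : thetaPart a t Finset.univ x =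
    1 / 2 * ∑ u, t u (x u) * linPart a Finset.univ u x ^ 2 := by
  simp only [thetaPart, sqPart_univ, ← Finset.sum_add_distrib]
  congr 1
  exact Finset.sum_congr rfl fun _ _ => by ring

theorem hasDerivAt_quadPart (hsymm : ∀ u v, a u v = a v u) (hdiag : ∀ u, a u u = 0) (k : ι)
    (x : ι → ℝ) (y : ℝ) :
    HasDerivAt (fun y => quadPart a Finset.univ (Function.update x k y))
      (linPart a Finset.univ k x) y := by
  have hk : k ∉ Finset.univ.erase k := Finset.notMem_erase k _
  have e : (fun y => quadPart a Finset.univ (Function.update x k y)) = fun y =>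
      quadPart a (Finset.univ.erase k) x + y * linPart a Finset.univ k x := by
    funext y
    rw [← Finset.insert_erase (Finset.mem_univ k), quadPart_insert hsymm hdiag hk,
      freeOf_quadPart hk, freeOf_linPart hk, Function.update_self,
      Finset.insert_erase (Finset.mem_univ k), linPart_univ_eq_erase hdiag]
  rw [e]
  simpa using ((hasDerivAt_id y).mul_const (linPart a Finset.univ k x)).const_add
    (quadPart a (Finset.univ.erase k) x)

/-- Revealing `k` last displays `Θ` as an explicit function of that coordinate: a quadratic
polynomial plus a multiple of `t k`. -/
theorem hasDerivAt_thetaPart (hsymm : ∀ u v, a u v = a v u) (hdiag : ∀ u, a u u = 0) (k : ι)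
    (x : ι → ℝ) {y : ℝ} (hy : HasDerivAt (t k) (dt k y) y) :
    HasDerivAt (fun y => thetaPart a t Finset.univ (Function.update x k y))
      (gradTheta a t dt k (Function.update x k y)) y := by
  have hk : k ∉ Finset.univ.erase k := Finset.notMem_erase k _
  have e : (fun y => thetaPart a t Finset.univ (Function.update x k y)) = fun y =>
      thetaPart a t (Finset.univ.erase k) x + (y * biPart a t (Finset.univ.erase k) k x +
        (y ^ 2 - 1) * (1 / 2 * kerSum t (fun u => a k u ^ 2) (Finset.univ.erase k) x) +
        (t k y - 1) * (1 / 2 * linPart a Finset.univ k x ^ 2)) := by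
    funext y
    rw [← Finset.insert_erase (Finset.mem_univ k), thetaPart_insert hsymm hdiag hk,
      freeOf_thetaPart hk, freeOf_biPart hk, freeOf_kerSum hk, freeOf_sqPart hk,
      Function.update_self, Finset.insert_erase (Finset.mem_univ k), sqPart_erase hdiag]
  have hb : biPart a t Finset.univ k (Function.update x k y) =
      biPart a t (Finset.univ.erase k) k x +
        y * kerSum t (fun u => a k u ^ 2) (Finset.univ.erase k) x := by
    rw [← Finset.insert_erase (Finset.mem_univ k), biPart_insert hdiag hk,
      freeOf_biPart hk, freeOf_kerSum hk, freeOf_linPart hk, hdiag,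
      Function.update_self, Finset.insert_erase (Finset.mem_univ k)]
    simp only [hsymm _ k, ← sq]
    ring
  rw [e]
  have h1 := (((hasDerivAt_id y).mul_const (biPart a t (Finset.univ.erase k) k x)).add
    ((((hasDerivAt_id y).pow 2).sub_const 1).mul_const
      (1 / 2 * kerSum t (fun u => a k u ^ 2) (Finset.univ.erase k) x))).add
    ((hy.sub_const 1).mul_const (1 / 2 * linPart a Finset.univ k x ^ 2))
  refine (h1.const_add (thetaPart a t (Finset.univ.erase k) x)).congr_deriv ?_
  rw [gradTheta, hb, Function.update_self, freeOf_linPart_self hdiag Finset.univ k x y]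
  simp only [id]
  ring

theorem LpLe.integrable_mul {α : Type*} [MeasurableSpace α] {μ : Measure α}
    [IsProbabilityMeasure μ] {f g : α → ℝ} {b c : ℝ} (hf : LpLe μ (4 : ℕ) f b)
    (hg : LpLe μ (4 : ℕ) g c) : Integrable (fun x => f x * g x) μ :=
  (hf.memLp.mono_exponent (p := 2) (by norm_num)).integrable_mul
    (hg.memLp.mono_exponent (p := 2) (by norm_num))

theorem LpLe.comp_coord {η : ℝ → ℝ} {k : ι} {C : ℝ}
    (hη : LpLe (ν k) (8 : ℕ) η C) : LpLe (Measure.pi ν) (8 : ℕ) (fun x => η (x k)) C := by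
  have := FreeOf.lpLe_mul (ν := ν) (k := k) (g := fun _ => 1) (fun _ _ => rfl) (by norm_num) hη
    (LpLe.const 1)
  simpa using this

/-- `(1/2) ∑_k t_k(x_k) (∑_v a_{kv} x_v) ∂_kΘ` -/
noncomputable def carre (a : ι → ι → ℝ) (t dt : ι → ℝ → ℝ) (x : ι → ℝ) : ℝ :=
  1 / 2 * ∑ k, t k (x k) * linPart a Finset.univ k x * gradTheta a t dt k x

variable {B : ℝ} {U : ι → Set ℝ}

theorem thetaPart_nonneg (hU : ∀ u, IsSteinKernel (ν u) (U u) (t u) (dt u)) (x : ι → ℝ) :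
    0 ≤ thetaPart a t Finset.univ x := by
  rw [thetaPart_univ]
  exact mul_nonneg (by norm_num) (Finset.sum_nonneg fun u _ =>
    mul_nonneg ((hU u).nonneg _) (sq_nonneg _))

theorem measurable_linPart
    (h : KernelMoments ν t B) (S : Finset ι) (k : ι) : Measurable (linPart a S k) :=
  (h.lpLe_linPart k S).measurable

theorem measurable_quadPart
    (h : KernelMoments ν t B) (hsymm : ∀ u v, a u v = a v u)
    (hdiag : ∀ u, a u u = 0) (S : Finset ι) : Measurable (quadPart a S) :=
  (h.lpLe_quadPart hsymm hdiag S).measurable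

theorem measurable_thetaPart
    (h : KernelMoments ν t B) (hsymm : ∀ u v, a u v = a v u)
    (hdiag : ∀ u, a u u = 0) (S : Finset ι) : Measurable (thetaPart a t S) := by
  simpa using (h.lpLe_thetaPart hsymm hdiag S).measurable.add_const (1 / 2 * ∑ k, rowSq a k)

theorem abs_div_add_le {θ ε : ℝ} (hθ : 0 ≤ θ) (hε : 0 < ε) (y : ℝ) : |y / (θ + ε)| ≤ |y| / ε := by
  rw [abs_div, abs_of_pos (by linarith : 0 < θ + ε)]
  exact div_le_div_of_nonneg_left (abs_nonneg y) hε (by linarith)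

/-- The one-variable Stein identity for `φ(F) Y_k / (Θ + ε)` as a function of the `k`-th coordinate.
Since `Y_k` is constant in that coordinate, only `F` and `Θ` are differentiated. The `ε` makes the
test function bounded before anything is known about negative moments of `Θ`. -/
theorem integral_parts_coord
    (h : KernelMoments ν t B) (hdt : ∀ u, LpLe (ν u) (8 : ℕ) (dt u) B)
    (hU : ∀ u, IsSteinKernel (ν u) (U u) (t u) (dt u))
    (hsymm : ∀ u v, a u v = a v u) (hdiag : ∀ u, a u u = 0) {φ ψ : ℝ → ℝ} (hφ : ∀ x, HasDerivAt φ (ψ x) x)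
    (hψ : Continuous ψ) {M : ℝ} (hM : ∀ x, |φ x| ≤ M ∧ |ψ x| ≤ M) {ε : ℝ} (hε : 0 < ε) (k : ι) :
    Integrable (fun x => ψ (quadPart a Finset.univ x) / (thetaPart a t Finset.univ x + ε) *
        (t k (x k) * linPart a Finset.univ k x ^ 2)) (Measure.pi ν) ∧
    Integrable (fun x => φ (quadPart a Finset.univ x) / (thetaPart a t Finset.univ x + ε) ^ 2 *
        (t k (x k) * linPart a Finset.univ k x * gradTheta a t dt k x)) (Measure.pi ν) ∧
    Integrable (fun x => φ (quadPart a Finset.univ x) / (thetaPart a t Finset.univ x + ε) *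
        (x k * linPart a Finset.univ k x)) (Measure.pi ν) ∧
    ∫ x, ψ (quadPart a Finset.univ x) / (thetaPart a t Finset.univ x + ε) *
        (t k (x k) * linPart a Finset.univ k x ^ 2) ∂(Measure.pi ν) =
      ∫ x, φ (quadPart a Finset.univ x) / (thetaPart a t Finset.univ x + ε) ^ 2 *
        (t k (x k) * linPart a Finset.univ k x * gradTheta a t dt k x) ∂(Measure.pi ν) +
      ∫ x, φ (quadPart a Finset.univ x) / (thetaPart a t Finset.univ x + ε) *
        (x k * linPart a Finset.univ k x) ∂(Measure.pi ν) := by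
  set F := quadPart a Finset.univ with hFdef
  set Θ := thetaPart a t Finset.univ with hΘdef
  set Y := linPart a Finset.univ k with hYdef
  have hΘ0 : ∀ x, 0 ≤ Θ x := thetaPart_nonneg hU
  have hFm : Measurable F := measurable_quadPart h hsymm hdiag _
  have hΘm : Measurable Θ := measurable_thetaPart h hsymm hdiag _
  have hφm : Measurable φ := (continuous_iff_continuousAt.2 fun x => (hφ x).continuousAt).measurable
  have hψm : Measurable ψ := hψ.measurable
  have hY8 : LpLe (Measure.pi ν) (8 : ℕ) Y _ := h.lpLe_linPart k _
  have ht8 := (h.lpLe_kernel k).comp_coord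
  have hx8 := (h.lpLe_id k).comp_coord
  have htY := ht8.mul hY8
  have hg4 := h.lpLe_gradTheta hdt hdiag (a := a) k
  have hbd1 : ∀ (χ : ℝ → ℝ), (∀ x, |χ x| ≤ M) → ∀ x, ‖χ (F x) / (Θ x + ε)‖ ≤ M / ε :=
    fun χ hχ x => (abs_div_add_le (hΘ0 x) hε _).trans (by gcongr; exact hχ _)
  have hbd2 : ∀ x, ‖φ (F x) / (Θ x + ε) ^ 2‖ ≤ M / ε / ε := fun x => by
    rw [sq, ← div_div]
    exact (abs_div_add_le (hΘ0 x) hε _).trans (by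
      gcongr
      exact hbd1 φ (fun x => (hM x).1) x)
  have hi1 : Integrable (fun x => ψ (F x) / (Θ x + ε) * (t k (x k) * Y x ^ 2))
      (Measure.pi ν) := by
    refine Integrable.bdd_mul (c := M / ε) ?_ (Measurable.aestronglyMeasurable (by fun_prop))
      (ae_of_all _ (hbd1 ψ fun x => (hM x).2))
    refine (htY.integrable_mul (hY8.exponent_mono (q := (4 : ℕ)) (by norm_num))).congr
      (ae_of_all _ fun x => ?_)
    simp only
    ring
  have hi2 : Integrable (fun x => φ (F x) / (Θ x + ε) ^ 2 *
      (t k (x k) * Y x * gradTheta a t dt k x)) (Measure.pi ν) :=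
    Integrable.bdd_mul (c := M / ε / ε) (htY.integrable_mul hg4)
      (Measurable.aestronglyMeasurable (by fun_prop))
      (ae_of_all _ hbd2)
  have hi3 : Integrable (fun x => φ (F x) / (Θ x + ε) * (x k * Y x)) (Measure.pi ν) :=
    Integrable.bdd_mul (c := M / ε) ((hx8.mul hY8).memLp.integrable (by norm_num))
      (Measurable.aestronglyMeasurable (by fun_prop))
      (ae_of_all _ (hbd1 φ fun x => (hM x).1))
  refine ⟨hi1, hi2, hi3, ?_⟩
  have hi12 : Integrable (fun x => ψ (F x) / (Θ x + ε) * (t k (x k) * Y x ^ 2) -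
      φ (F x) / (Θ x + ε) ^ 2 * (t k (x k) * Y x * gradTheta a t dt k x)) (Measure.pi ν) :=
    hi1.sub hi2
  -- The two terms containing `t k` are merged first: together they form the single expression `t
  -- h'` required by the Stein identity.
  rw [← sub_eq_iff_eq_add', ← integral_sub hi1 hi2, ← integral_update hi12 k,
    ← integral_update hi3 k]
  refine integral_congr_ae ?_
  filter_upwards [ae_integrable_update hi12 k] with x hx
  have hYx : ∀ y, Y (Function.update x k y) = Y x := freeOf_linPart_self hdiag _ k x
  have hup : Measurable fun y => Function.update x k y := measurable_update x
  have hd : ∀ y ∈ U k, HasDerivAt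
      (fun y => φ (F (Function.update x k y)) / (Θ (Function.update x k y) + ε) * Y x)
      ((ψ (F (Function.update x k y)) / (Θ (Function.update x k y) + ε) * Y x -
        φ (F (Function.update x k y)) / (Θ (Function.update x k y) + ε) ^ 2 *
          gradTheta a t dt k (Function.update x k y)) * Y x) y := by
    intro y hy
    have hF1 := hasDerivAt_quadPart hsymm hdiag k x y
    have hΘ1 := (hasDerivAt_thetaPart hsymm hdiag k x ((hU k).hasDerivAt y hy)).add_const ε
    have hne : Θ (Function.update x k y) + ε ≠ 0 := by
      have := hΘ0 (Function.update x k y)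
      positivity
    have h1 := (((hφ (F (Function.update x k y))).comp y hF1).div hΘ1 hne).mul_const (Y x)
    refine h1.congr_deriv ?_
    simp only [Function.comp, ← hFdef, ← hΘdef, ← hYdef]
    field_simp
  have hint : ∀ y, ψ (F (Function.update x k y)) / (Θ (Function.update x k y) + ε) *
        (t k (Function.update x k y k) * Y (Function.update x k y) ^ 2) -
      φ (F (Function.update x k y)) / (Θ (Function.update x k y) + ε) ^ 2 *
        (t k (Function.update x k y k) * Y (Function.update x k y) *
          gradTheta a t dt k (Function.update x k y)) =
      t k y * ((ψ (F (Function.update x k y)) / (Θ (Function.update x k y) + ε) * Y x -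
        φ (F (Function.update x k y)) / (Θ (Function.update x k y) + ε) ^ 2 *
          gradTheta a t dt k (Function.update x k y)) * Y x) := by
    intro y
    rw [hYx, Function.update_self]
    ring
  simp only [hint] at hx ⊢
  rw [(hU k).integral_mul_deriv _ _ (by fun_prop) hd ⟨M / ε * |Y x|, fun y => ?_⟩ hx]
  · refine integral_congr_ae (ae_of_all _ fun y => ?_)
    simp only [hYx, Function.update_self]
    ring
  · rw [abs_mul]
    gcongr
    exact hbd1 φ (fun x => (hM x).1) _

theorem quadPart_univ (x : ι → ℝ) : quadPart a Finset.univ x =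
    1 / 2 * ∑ k, x k * linPart a Finset.univ k x := by
  rw [quadPart, Finset.mul_sum]
  exact Finset.sum_congr rfl fun _ _ => by ring

theorem integral_parts_regularized
    (h : KernelMoments ν t B) (hdt : ∀ u, LpLe (ν u) (8 : ℕ) (dt u) B)
    (hU : ∀ u, IsSteinKernel (ν u) (U u) (t u) (dt u))
    (hsymm : ∀ u v, a u v = a v u) (hdiag : ∀ u, a u u = 0) {φ ψ : ℝ → ℝ} (hφ : ∀ x, HasDerivAt φ (ψ x) x)
    (hψ : Continuous ψ) {M : ℝ} (hM : ∀ x, |φ x| ≤ M ∧ |ψ x| ≤ M) {ε : ℝ} (hε : 0 < ε) :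
    ∫ x, ψ (quadPart a Finset.univ x) / (thetaPart a t Finset.univ x + ε) *
        thetaPart a t Finset.univ x ∂(Measure.pi ν) =
      ∫ x, φ (quadPart a Finset.univ x) / (thetaPart a t Finset.univ x + ε) ^ 2 *
        carre a t dt x ∂(Measure.pi ν) +
      ∫ x, φ (quadPart a Finset.univ x) / (thetaPart a t Finset.univ x + ε) *
        quadPart a Finset.univ x ∂(Measure.pi ν) := by
  have hk := fun k => integral_parts_coord h hdt hU hsymm hdiag hφ hψ hM hε k
  have e1 : ∀ (c : ℝ) (f : ι → ℝ), c * (1 / 2 * ∑ k, f k) = 1 / 2 * ∑ k, c * f k := by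
    intro c f
    rw [← Finset.mul_sum]
    ring
  have e2 : ∀ x, φ (quadPart a Finset.univ x) / (thetaPart a t Finset.univ x + ε) *
      quadPart a Finset.univ x = 1 / 2 * ∑ k, φ (quadPart a Finset.univ x) /
        (thetaPart a t Finset.univ x + ε) * (x k * linPart a Finset.univ k x) := by
    intro x
    rw [← e1, ← quadPart_univ]
  have e3 : ∀ x, ψ (quadPart a Finset.univ x) / (thetaPart a t Finset.univ x + ε) *
      thetaPart a t Finset.univ x = 1 / 2 * ∑ k, ψ (quadPart a Finset.univ x) /
        (thetaPart a t Finset.univ x + ε) * (t k (x k) * linPart a Finset.univ k x ^ 2) := by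
    intro x
    rw [← e1, ← thetaPart_univ]
  simp only [e2, e3, carre, e1, integral_const_mul]
  rw [integral_finsetSum _ fun k _ => (hk k).1, integral_finsetSum _ fun k _ => (hk k).2.1,
    integral_finsetSum _ fun k _ => (hk k).2.2.1, ← mul_add, ← Finset.sum_add_distrib]
  congr 1
  exact Finset.sum_congr rfl fun k _ => (hk k).2.2.2

/-- Integration by parts: the score of the quadratic form is `-E[F/Θ + G/Θ² | F]`. -/
theorem integral_deriv_comp_quadPart
    (h : KernelMoments ν t B) (hdt : ∀ u, LpLe (ν u) (8 : ℕ) (dt u) B)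
    (hU : ∀ u, IsSteinKernel (ν u) (U u) (t u) (dt u))
    (hsymm : ∀ u v, a u v = a v u) (hdiag : ∀ u, a u u = 0) (hpos : ∀ᵐ x ∂(Measure.pi ν), 0 < thetaPart a t Finset.univ x)
    (hF : Integrable (fun x => quadPart a Finset.univ x / thetaPart a t Finset.univ x)
      (Measure.pi ν))
    (hG : Integrable (fun x => carre a t dt x / thetaPart a t Finset.univ x ^ 2) (Measure.pi ν))
    {φ ψ : ℝ → ℝ} (hφ : ∀ x, HasDerivAt φ (ψ x) x)
    (hψ : Continuous ψ) {M : ℝ} (hM : ∀ x, |φ x| ≤ M ∧ |ψ x| ≤ M) :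
    ∫ x, ψ (quadPart a Finset.univ x) ∂(Measure.pi ν) =
      ∫ x, φ (quadPart a Finset.univ x) *
        (quadPart a Finset.univ x / thetaPart a t Finset.univ x +
          carre a t dt x / thetaPart a t Finset.univ x ^ 2) ∂(Measure.pi ν) := by
  set F := quadPart a Finset.univ with hFdef
  set Θ := thetaPart a t Finset.univ with hΘdef
  set G := carre a t dt with hGdef
  have hΘ0 : ∀ x, 0 ≤ Θ x := thetaPart_nonneg hU
  have hFm : Measurable F := measurable_quadPart h hsymm hdiag _
  have hΘm : Measurable Θ := measurable_thetaPart h hsymm hdiag _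
  have hGm : Measurable G := by
    have h1 := fun k => (h.lpLe_gradTheta hdt hdiag (a := a) k).measurable
    have h2 := fun k => measurable_linPart h (a := a) Finset.univ k
    have h3 := fun k => (h.lpLe_kernel k).measurable
    rw [hGdef]
    unfold carre
    fun_prop
  have hφm : Measurable φ := (continuous_iff_continuousAt.2 fun x => (hφ x).continuousAt).measurable
  have hψm : Measurable ψ := hψ.measurable
  have hM0 : 0 ≤ M := (abs_nonneg _).trans (hM 0).1
  have hreg : ∀ n : ℕ, ∫ x, ψ (F x) / (Θ x + 1 / ((n : ℝ) + 1)) * Θ x ∂(Measure.pi ν) =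
      ∫ x, φ (F x) / (Θ x + 1 / ((n : ℝ) + 1)) ^ 2 * G x ∂(Measure.pi ν) +
      ∫ x, φ (F x) / (Θ x + 1 / ((n : ℝ) + 1)) * F x ∂(Measure.pi ν) := fun n =>
    integral_parts_regularized h hdt hU hsymm hdiag hφ hψ hM (by positivity)
  have hlim : ∀ x, Tendsto (fun n : ℕ => Θ x + 1 / ((n : ℝ) + 1)) atTop (𝓝 (Θ x)) := fun x => by
    simpa using tendsto_one_div_add_atTop_nhds_zero_nat.const_add (Θ x)
  have hge : ∀ x (n : ℕ), Θ x ≤ Θ x + 1 / ((n : ℝ) + 1) := fun x n => by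
    have : 0 < 1 / ((n : ℝ) + 1) := by positivity
    linarith
  -- Removing the regularization needs `Θ > 0` almost surely; the ratio `Θ / (Θ + ε)` is at most `1`
  -- and tends to `1`.
  have l1 : Tendsto (fun n : ℕ => ∫ x, ψ (F x) / (Θ x + 1 / ((n : ℝ) + 1)) * Θ x ∂(Measure.pi ν))
      atTop (𝓝 (∫ x, ψ (F x) ∂(Measure.pi ν))) := by
    refine tendsto_integral_of_dominated_convergence (fun _ => M)
      (fun n => Measurable.aestronglyMeasurable (by fun_prop)) (integrable_const M) (fun n => ?_) ?_
    · filter_upwards [hpos] with x hx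
      have h1 := hge x n
      rw [div_mul_eq_mul_div, mul_div_assoc, norm_mul, Real.norm_eq_abs, Real.norm_eq_abs,
        abs_of_nonneg (div_nonneg hx.le (hx.le.trans h1))]
      calc |ψ (F x)| * (Θ x / (Θ x + 1 / ((n : ℝ) + 1))) ≤ M * 1 := by
            gcongr
            · exact (hM _).2
            · exact div_le_one_of_le₀ h1 (hx.le.trans h1)
        _ = M := mul_one M
    · filter_upwards [hpos] with x hx
      have := (((tendsto_const_nhds (x := ψ (F x))).div (hlim x) hx.ne').mul_const (Θ x))
      rwa [div_mul_cancel₀ _ hx.ne'] at this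
  have l2 : Tendsto (fun n : ℕ => ∫ x, φ (F x) / (Θ x + 1 / ((n : ℝ) + 1)) ^ 2 * G x
      ∂(Measure.pi ν)) atTop (𝓝 (∫ x, φ (F x) / Θ x ^ 2 * G x ∂(Measure.pi ν))) := by
    refine tendsto_integral_of_dominated_convergence (fun x => M * |G x / Θ x ^ 2|)
      (fun n => Measurable.aestronglyMeasurable (by fun_prop)) (hG.abs.const_mul M) (fun n => ?_) ?_
    · filter_upwards [hpos] with x hx
      rw [div_mul_eq_mul_div, mul_div_assoc, norm_mul, Real.norm_eq_abs, Real.norm_eq_abs,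
        abs_div, abs_div, abs_pow, abs_pow, abs_of_pos hx, abs_of_pos (hx.trans_le (hge x n))]
      gcongr
      · exact (hM _).1
      · exact hge x n
    · filter_upwards [hpos] with x hx
      exact ((tendsto_const_nhds (x := φ (F x))).div ((hlim x).pow 2) (by positivity)).mul_const (G x)
  have l3 : Tendsto (fun n : ℕ => ∫ x, φ (F x) / (Θ x + 1 / ((n : ℝ) + 1)) * F x
      ∂(Measure.pi ν)) atTop (𝓝 (∫ x, φ (F x) / Θ x * F x ∂(Measure.pi ν))) := by
    refine tendsto_integral_of_dominated_convergence (fun x => M * |F x / Θ x|)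
      (fun n => Measurable.aestronglyMeasurable (by fun_prop)) (hF.abs.const_mul M) (fun n => ?_) ?_
    · filter_upwards [hpos] with x hx
      rw [div_mul_eq_mul_div, mul_div_assoc, norm_mul, Real.norm_eq_abs, Real.norm_eq_abs,
        abs_div, abs_div, abs_of_pos hx, abs_of_pos (hx.trans_le (hge x n))]
      gcongr
      · exact (hM _).1
      · exact hge x n
    · filter_upwards [hpos] with x hx
      exact ((tendsto_const_nhds (x := φ (F x))).div (hlim x) hx.ne').mul_const (F x)
  simp only [hreg] at l1
  rw [tendsto_nhds_unique l1 (l2.add l3)]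
  have hφb : ∀ᵐ x ∂(Measure.pi ν), ‖φ (F x)‖ ≤ M := ae_of_all _ fun x => (hM _).1
  have j1 : Integrable (fun x => φ (F x) * (F x / Θ x)) (Measure.pi ν) :=
    hF.bdd_mul (Measurable.aestronglyMeasurable (by fun_prop)) hφb
  have j2 : Integrable (fun x => φ (F x) * (G x / Θ x ^ 2)) (Measure.pi ν) :=
    hG.bdd_mul (Measurable.aestronglyMeasurable (by fun_prop)) hφb
  simp only [mul_add]
  rw [integral_add j1 j2, add_comm]
  simp only [div_mul_eq_mul_div, mul_div_assoc]

end IntegrationByParts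

/-! ### The bound for a product measure -/

theorem abs_arctan_le (x : ℝ) : |Real.arctan x| ≤ |x| := by
  have key : ∀ y : ℝ, 0 ≤ y → Real.arctan y ≤ y := fun y hy => by
    have := Real.le_tan (Real.arctan_nonneg.2 hy) (Real.arctan_lt_pi_div_two y)
    rwa [Real.tan_arctan] at this
  rcases le_total 0 x with h | h
  · rw [abs_of_nonneg (Real.arctan_nonneg.2 h), abs_of_nonneg h]
    exact key x h
  · have h1 := key (-x) (by linarith)
    have h2 := Real.arctan_nonneg.2 (neg_nonneg.2 h)
    rw [Real.arctan_neg] at h1 h2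
    rw [abs_of_nonpos (by linarith), abs_of_nonpos h]
    exact h1

/-- The Stein identity for `h(x) = x` would give this at once, but `h` must be bounded. It is
approximated by `c arctan(x/c)`, dominated by `|x|` with derivative at most `1`, as `c → ∞`. -/
theorem IsSteinKernel.integral_eq_one {ν : Measure ℝ} [IsProbabilityMeasure ν] {U : Set ℝ}
    {t dt : ℝ → ℝ} (hU : IsSteinKernel ν U t dt) (ht : Integrable t ν)
    (hsq : Integrable (fun x => x ^ 2) ν) (h1 : ∫ x, x ^ 2 ∂ν = 1) : ∫ x, t x ∂ν = 1 := by
  set c : ℕ → ℝ := fun n => (n : ℝ) + 1 with hc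
  have hc0 : ∀ n, 0 < c n := fun n => by positivity
  have hd : ∀ (n : ℕ) (x : ℝ), HasDerivAt (fun x => c n * Real.arctan (x / c n))
      (1 / (1 + (x / c n) ^ 2)) x := by
    intro n x
    have h2 := ((hasDerivAt_id x).div_const (c n)).arctan.const_mul (c n)
    refine h2.congr_deriv ?_
    have := (hc0 n).ne'
    simp only [id]
    field_simp
  have hle : ∀ (n : ℕ) (x : ℝ), ‖1 / (1 + (x / c n) ^ 2)‖ ≤ 1 := by
    intro n x
    rw [Real.norm_eq_abs, abs_of_nonneg (by positivity)]
    exact div_le_one_of_le₀ (by nlinarith [sq_nonneg (x / c n)]) (by positivity)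
  have harc : ∀ (n : ℕ) (x : ℝ), |c n * Real.arctan (x / c n)| ≤ |x| := by
    intro n x
    rw [abs_mul, abs_of_pos (hc0 n)]
    have h2 : |Real.arctan (x / c n)| ≤ |x / c n| := abs_arctan_le _
    calc c n * |Real.arctan (x / c n)| ≤ c n * |x / c n| := by
          have := hc0 n
          gcongr
      _ = |x| := by
          rw [abs_div, abs_of_pos (hc0 n), mul_div_cancel₀ _ (hc0 n).ne']
  have hdm : ∀ n : ℕ, Measurable fun x : ℝ => 1 / (1 + (x / c n) ^ 2) := fun n => by fun_prop
  have ham : ∀ n : ℕ, Measurable fun x : ℝ => c n * Real.arctan (x / c n) := fun n => by fun_prop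
  have hibp : ∀ n : ℕ, ∫ x, t x * (1 / (1 + (x / c n) ^ 2)) ∂ν =
      ∫ x, x * (c n * Real.arctan (x / c n)) ∂ν := fun n =>
    hU.integral_mul_deriv _ _ (ham n) (fun x _ => hd n x)
      ⟨c n * (Real.pi / 2), fun x => by
        rw [abs_mul, abs_of_pos (hc0 n)]
        have := hc0 n
        gcongr
        exact (abs_lt.2 ⟨Real.neg_pi_div_two_lt_arctan _, Real.arctan_lt_pi_div_two _⟩).le⟩
      (ht.mul_bdd (c := 1) (hdm n).aestronglyMeasurable (ae_of_all _ (hle n)))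
  have hinv : ∀ x : ℝ, Tendsto (fun n => x / c n) atTop (𝓝 0) := fun x => by
    have := (tendsto_one_div_add_atTop_nhds_zero_nat (𝕜 := ℝ)).const_mul x
    simpa [hc, div_eq_mul_inv] using this
  have l1 : Tendsto (fun n => ∫ x, t x * (1 / (1 + (x / c n) ^ 2)) ∂ν) atTop
      (𝓝 (∫ x, t x ∂ν)) := by
    refine tendsto_integral_of_dominated_convergence (fun x => |t x|)
      (fun n => (hU.measurable.mul (hdm n)).aestronglyMeasurable) ht.abs
      (fun n => ae_of_all _ fun x => ?_) (ae_of_all _ fun x => ?_)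
    · rw [norm_mul]
      exact mul_le_of_le_one_right (abs_nonneg _) (hle n x)
    · have h2 : Tendsto (fun n => 1 + (x / c n) ^ 2) atTop (𝓝 (1 + 0 ^ 2)) :=
        ((hinv x).pow 2).const_add 1
      have h3 := ((tendsto_const_nhds (x := (1 : ℝ))).div h2 (by norm_num)).const_mul (t x)
      simpa using h3
  have l2 : Tendsto (fun n => ∫ x, x * (c n * Real.arctan (x / c n)) ∂ν) atTop
      (𝓝 (∫ x, x ^ 2 ∂ν)) := by
    refine tendsto_integral_of_dominated_convergence (fun x => x ^ 2)
      (fun n => (measurable_id.mul (ham n)).aestronglyMeasurable) hsq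
      (fun n => ae_of_all _ fun x => ?_) (ae_of_all _ fun x => ?_)
    · rw [norm_mul, Real.norm_eq_abs, Real.norm_eq_abs, ← sq_abs, sq]
      exact mul_le_mul_of_nonneg_left (harc n x) (abs_nonneg x)
    · have h2 : Tendsto (fun n => c n * Real.arctan (x / c n)) atTop (𝓝 x) := by
        rcases eq_or_ne x 0 with rfl | hx
        · simp
        · have h3 : Tendsto (fun n => x / c n) atTop (𝓝[≠] 0) :=
            tendsto_nhdsWithin_iff.2 ⟨hinv x, Eventually.of_forall fun n =>
              div_ne_zero hx (hc0 n).ne'⟩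
          have h4 := (hasDerivAt_iff_tendsto_slope.1 (Real.hasDerivAt_arctan 0)).comp h3
          have h5 := h4.const_mul x
          simp only [slope, Function.comp, vsub_eq_sub, Real.arctan_zero, sub_zero, smul_eq_mul,
            ne_eq, OfNat.ofNat_ne_zero, not_false_eq_true, zero_pow, add_zero, div_one,
            mul_one] at h5
          refine h5.congr fun n => ?_
          have := (hc0 n).ne'
          field_simp
      simpa [sq] using h2.const_mul x
  simp only [hibp] at l1
  rw [tendsto_nhds_unique l1 l2, h1]

section Core

variable {ι : Type*} [Fintype ι] [DecidableEq ι] {ν : ι → Measure ℝ}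
  [∀ i, IsProbabilityMeasure (ν i)] {a : ι → ι → ℝ} {t dt : ι → ℝ → ℝ}

/-- Cauchy–Schwarz for the nonnegative weights `t k (x k)`. It extracts one factor `Θ`, reducing
`Θ⁻⁴` to `Θ⁻³`. -/
theorem carre_sq_le {U : ι → Set ℝ} (hU : ∀ u, IsSteinKernel (ν u) (U u) (t u) (dt u))
    (x : ι → ℝ) :
    carre a t dt x ^ 2 ≤ thetaPart a t Finset.univ x *
      (1 / 2 * ∑ k, t k (x k) * gradTheta a t dt k x ^ 2) := by
  have h1 := Finset.sum_sq_le_sum_mul_sum_of_sq_le_mul Finset.univ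
    (r := fun k => t k (x k) * linPart a Finset.univ k x * gradTheta a t dt k x)
    (f := fun k => t k (x k) * linPart a Finset.univ k x ^ 2)
    (g := fun k => t k (x k) * gradTheta a t dt k x ^ 2)
    (fun k _ => mul_nonneg ((hU k).nonneg _) (sq_nonneg _))
    (fun k _ => mul_nonneg ((hU k).nonneg _) (sq_nonneg _)) (fun k _ => le_of_eq (by ring))
  rw [carre, thetaPart_univ]
  nlinarith

/-- Since `Θ + Θ⁻¹ ≥ 2` and `E Θ = 1`, one gets `E Θ⁻¹ ≥ 1`. -/
theorem lpLe_inv_thetaPart_one_le {B : ℝ} (h : KernelMoments ν t B)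
    (hsymm : ∀ u v, a u v = a v u) (hdiag : ∀ u, a u u = 0) (hsum : ∑ k, rowSq a k = 2)
    (hpos : ∀ᵐ x ∂(Measure.pi ν), 0 < thetaPart a t Finset.univ x) {n : ℝ}
    (hn : LpLe (Measure.pi ν) (8 : ℕ) (fun x => (thetaPart a t Finset.univ x)⁻¹) n) : 1 ≤ n := by
  obtain ⟨hi, he⟩ := h.integral_thetaPart hsymm hdiag (a := a) Finset.univ
  rw [hsum] at he
  have hn1 : LpLe (Measure.pi ν) (1 : ℕ) (fun x => (thetaPart a t Finset.univ x)⁻¹) n :=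
    hn.exponent_mono (by norm_num)
  have h1 := hn1.integral_pow_le one_ne_zero
  have h2 := hn1.integrable_pow one_ne_zero
  simp only [pow_one] at h1 h2
  have h3 : ∫ x, (2 : ℝ) ∂(Measure.pi ν) ≤ ∫ x, (thetaPart a t Finset.univ x +
      |(thetaPart a t Finset.univ x)⁻¹|) ∂(Measure.pi ν) := by
    refine integral_mono_ae (integrable_const _) (hi.add h2) ?_
    filter_upwards [hpos] with x hx
    rw [abs_of_pos (inv_pos.2 hx)]
    have h4 : thetaPart a t Finset.univ x * (thetaPart a t Finset.univ x)⁻¹ = 1 :=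
      mul_inv_cancel₀ hx.ne'
    nlinarith [sq_nonneg (thetaPart a t Finset.univ x - 1), inv_pos.2 hx,
      mul_nonneg (inv_pos.2 hx).le (sq_nonneg (thetaPart a t Finset.univ x - 1))]
  rw [integral_add hi h2, he] at h3
  rw [integral_const, probReal_univ, one_smul] at h3
  linarith

/-- Hölder with `1/8 + 3/8 + 2/4 = 1`, organized through the `L⁴` norm of `√(t Θ⁻³)`, whose fourth
power is `(t Θ⁻¹)² (Θ⁻²)²`. -/
theorem integral_kernel_mul_grad_sq_le {B : ℝ} (h : KernelMoments ν t B)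
    {U : ι → Set ℝ} (hU : ∀ u, IsSteinKernel (ν u) (U u) (t u) (dt u))
    (hdt : ∀ u, LpLe (ν u) (8 : ℕ) (dt u) B) (hdiag : ∀ u, a u u = 0) {n : ℝ}
    (hn : LpLe (Measure.pi ν) (8 : ℕ) (fun x => (thetaPart a t Finset.univ x)⁻¹) n) (k : ι) :
    Integrable (fun x => t k (x k) * (thetaPart a t Finset.univ x)⁻¹ ^ 3 *
      gradTheta a t dt k x ^ 2) (Measure.pi ν) ∧
    ∫ x, t k (x k) * (thetaPart a t Finset.univ x)⁻¹ ^ 3 *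
      gradTheta a t dt k x ^ 2 ∂(Measure.pi ν) ≤ B * n ^ 3 * gradBound a B k ^ 2 := by
  have ht0 : ∀ x : ι → ℝ, 0 ≤ t k (x k) := fun x => (hU k).nonneg _
  have hΘ0 : ∀ x : ι → ℝ, 0 ≤ (thetaPart a t Finset.univ x)⁻¹ := fun x =>
    inv_nonneg.2 (thetaPart_nonneg hU x)
  have htn := (h.lpLe_kernel k).comp_coord.mul hn
  have hnn := hn.mul hn
  have hB := h.nonneg
  have hn0 := hn.nonneg
  obtain ⟨hi, hle⟩ := integral_pow_mul_sq_le (m := 2) htn hnn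
  have h0 : ∀ x, 0 ≤ t k (x k) * (thetaPart a t Finset.univ x)⁻¹ ^ 3 := fun x =>
    mul_nonneg (ht0 x) (pow_nonneg (hΘ0 x) 3)
  have e1 : ∀ x, |t k (x k) * (thetaPart a t Finset.univ x)⁻¹| ^ 2 *
      |(thetaPart a t Finset.univ x)⁻¹ * (thetaPart a t Finset.univ x)⁻¹| ^ 2 =
      |√(t k (x k) * (thetaPart a t Finset.univ x)⁻¹ ^ 3)| ^ 4 := by
    intro x
    rw [abs_of_nonneg (Real.sqrt_nonneg _), show 4 = 2 * 2 from rfl, pow_mul _ 2 2,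
      Real.sq_sqrt (h0 x), sq_abs, sq_abs]
    ring
  simp only [e1] at hi hle
  have hu : LpLe (Measure.pi ν) (4 : ℕ)
      (fun x => √(t k (x k) * (thetaPart a t Finset.univ x)⁻¹ ^ 3)) (√(B * n ^ 3)) := by
    have hm1 := (h.lpLe_kernel k).comp_coord.measurable
    have hm2 := hn.measurable
    refine LpLe.of_integral_pow_le (by norm_num) (hm1.mul (hm2.pow_const 3)).sqrt (Real.sqrt_nonneg _) hi ?_
    rw [show 4 = 2 * 2 from rfl, pow_mul (√(B * n ^ 3)) 2 2, Real.sq_sqrt (by positivity)]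
    refine hle.trans (le_of_eq ?_)
    ring
  obtain ⟨hi2, hle2⟩ := integral_pow_mul_sq_le (m := 2) hu (h.lpLe_gradTheta hdt hdiag (a := a) k)
  have e2 : ∀ x, |√(t k (x k) * (thetaPart a t Finset.univ x)⁻¹ ^ 3)| ^ 2 *
      |gradTheta a t dt k x| ^ 2 =
      t k (x k) * (thetaPart a t Finset.univ x)⁻¹ ^ 3 * gradTheta a t dt k x ^ 2 := by
    intro x
    rw [sq_abs, sq_abs, Real.sq_sqrt (h0 x)]
  simp only [e2] at hi2 hle2
  rw [Real.sq_sqrt (by positivity)] at hle2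
  exact ⟨hi2, hle2⟩

theorem fisherDistance_quadPart_le_of_lpLe {B : ℝ} (h : KernelMoments ν t B)
    {U : ι → Set ℝ} (hU : ∀ u, IsSteinKernel (ν u) (U u) (t u) (dt u))
    (hdt : ∀ u, LpLe (ν u) (8 : ℕ) (dt u) B)
    (hsymm : ∀ u v, a u v = a v u) (hdiag : ∀ u, a u u = 0) (hsum : ∑ k, rowSq a k = 2)
    (hpos : ∀ᵐ x ∂(Measure.pi ν), 0 < thetaPart a t Finset.univ x) {n : ℝ}
    (hn : LpLe (Measure.pi ν) (8 : ℕ) (fun x => (thetaPart a t Finset.univ x)⁻¹) n) :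
    fisherDistance ((Measure.pi ν).map (quadPart a Finset.univ)) ≤
      ENNReal.ofReal (30000000000 * B ^ 10 * fourthSum a * n ^ 3) := by
  have hn1 := lpLe_inv_thetaPart_one_le h hsymm hdiag hsum hpos hn
  have hgrad := fun k => integral_kernel_mul_grad_sq_le h hU hdt hdiag hn (a := a) k
  have hF8 := h.lpLe_quadPart hsymm hdiag (a := a) Finset.univ
  have hΘ4 := h.lpLe_thetaPart hsymm hdiag (a := a) Finset.univ
  have hmean := h.integral_quadPart hsymm hdiag (a := a)
  have hB := h.one_le
  have hR := fourthSum_nonneg a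
  have hg2 := sum_gradBound_sq_le hsymm hB (a := a)
  have hcs := carre_sq_le hU (a := a)
  have hGm : Measurable (carre a t dt) := by
    have h1 := fun k => (h.lpLe_gradTheta hdt hdiag (a := a) k).measurable
    have h2 := fun k => measurable_linPart h (a := a) Finset.univ k
    have h3 := fun k => (h.lpLe_kernel k).measurable
    unfold carre
    fun_prop
  have hΘm := measurable_thetaPart h hsymm hdiag (a := a) Finset.univ
  have hparts := fun hF hG (φ ψ : ℝ → ℝ) hφ hψ (M : ℝ) hM =>
    integral_deriv_comp_quadPart h hdt hU hsymm hdiag (a := a) hpos hF hG (φ := φ) (ψ := ψ)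
      hφ hψ (M := M) hM
  rw [hsum] at hF8 hΘ4 hmean
  set F := quadPart a Finset.univ
  set Θ := thetaPart a t Finset.univ
  set G := carre a t dt
  have hFm : Measurable F := hF8.measurable
  have hFn := hF8.mul hn
  have hFdiv : Integrable (fun x => F x / Θ x) (Measure.pi ν) := by
    simp only [div_eq_mul_inv]
    exact hFn.memLp.integrable (by norm_num)
  obtain ⟨hAi, hAle⟩ := integral_pow_mul_sq_le (m := 2) hFn hΘ4
  have hAeq : ∀ x, |F x * (Θ x)⁻¹| ^ 2 * |Θ x - 1 / 2 * 2| ^ 2 =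
      (F x * (Θ x)⁻¹ * (Θ x - 1)) ^ 2 := fun x => by
    rw [sq_abs, sq_abs]
    ring
  simp only [hAeq] at hAi hAle
  set H : (ι → ℝ) → ℝ := fun x =>
    1 / 2 * ∑ k, t k (x k) * (Θ x)⁻¹ ^ 3 * gradTheta a t dt k x ^ 2 with hH
  have hHi : Integrable H (Measure.pi ν) :=
    (integrable_finsetSum _ fun k _ => (hgrad k).1).const_mul _
  have hHle : ∫ x, H x ∂(Measure.pi ν) ≤ 30000 * B ^ 7 * fourthSum a * n ^ 3 := by
    rw [hH, integral_const_mul, integral_finsetSum _ fun k _ => (hgrad k).1]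
    have h1 := Finset.sum_le_sum fun k (_ : k ∈ Finset.univ) => (hgrad k).2
    rw [← Finset.mul_sum] at h1
    have h2 : B * n ^ 3 * ∑ k, gradBound a B k ^ 2 ≤
        B * n ^ 3 * (60000 * B ^ 6 * fourthSum a) := by gcongr
    nlinarith
  have hGH : ∀ᵐ x ∂(Measure.pi ν), (G x / Θ x ^ 2) ^ 2 ≤ H x := by
    filter_upwards [hpos] with x hx
    have e : H x = (Θ x * (1 / 2 * ∑ k, t k (x k) * gradTheta a t dt k x ^ 2)) / Θ x ^ 4 := by
      rw [hH]
      have : ∀ k, t k (x k) * (Θ x)⁻¹ ^ 3 * gradTheta a t dt k x ^ 2 =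
          (Θ x)⁻¹ ^ 3 * (t k (x k) * gradTheta a t dt k x ^ 2) := fun k => by ring
      simp only [this, ← Finset.mul_sum]
      field_simp
    rw [e, div_pow, ← pow_mul]
    gcongr
    exact hcs x
  have hG2 : MemLp (fun x => G x / Θ x ^ 2) 2 (Measure.pi ν) := by
    have hm : Measurable fun x => G x / Θ x ^ 2 := by fun_prop
    refine (memLp_two_iff_integrable_sq hm.aestronglyMeasurable).2 ?_
    refine hHi.mono' (hm.pow_const 2).aestronglyMeasurable ?_
    filter_upwards [hGH] with x hx
    rwa [Real.norm_eq_abs, abs_of_nonneg (sq_nonneg _)]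
  have hA2 : MemLp (fun x => F x * (Θ x)⁻¹ * (Θ x - 1)) 2 (Measure.pi ν) := by
    have hm : Measurable fun x => F x * (Θ x)⁻¹ * (Θ x - 1) := by fun_prop
    exact (memLp_two_iff_integrable_sq hm.aestronglyMeasurable).2 hAi
  -- This isolates the two small quantities: the fluctuation `Θ - 1` and the gradient term `G`.
  have hdiff : ∀ᵐ x ∂(Measure.pi ν), F x - (F x / Θ x + G x / Θ x ^ 2) =
      F x * (Θ x)⁻¹ * (Θ x - 1) - G x / Θ x ^ 2 := by
    filter_upwards [hpos] with x hx
    field_simp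
    ring
  have hdiff2 : MemLp (fun x => F x - (F x / Θ x + G x / Θ x ^ 2)) 2 (Measure.pi ν) :=
    (hA2.sub hG2).ae_eq (hdiff.mono fun x hx => hx.symm)
  have hFi : Integrable F (Measure.pi ν) := hF8.memLp.integrable (by norm_num)
  have hvar : variance id ((Measure.pi ν).map F) = 1 := by
    rw [variance_id_map hFm.aemeasurable,
      variance_of_integral_eq_zero hFm.aemeasurable hmean.1, hmean.2]
    norm_num
  refine (fisherDistance_map_le (S := fun x => F x / Θ x + G x / Θ x ^ 2) hFm
    (hFdiv.add (hG2.integrable (by norm_num))) hdiff2 hmean.1 hvar ?_).trans ?_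
  · rintro φ ψ hφ hψ ⟨M, hM⟩
    exact hparts hFdiv (hG2.integrable (by norm_num)) φ ψ hφ hψ M hM
  · have e : ∫⁻ x, ‖F x - (F x / Θ x + G x / Θ x ^ 2)‖ₑ ^ 2 ∂(Measure.pi ν) =
        ENNReal.ofReal (∫ x, (F x - (F x / Θ x + G x / Θ x ^ 2)) ^ 2 ∂(Measure.pi ν)) := by
      rw [ofReal_integral_eq_lintegral_ofReal hdiff2.integrable_sq
        (ae_of_all _ fun x => sq_nonneg _)]
      refine lintegral_congr fun x => ?_
      rw [Real.enorm_eq_ofReal_abs, ← ENNReal.ofReal_pow (abs_nonneg _), sq_abs]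
    rw [e]
    refine ENNReal.ofReal_le_ofReal ?_
    calc ∫ x, (F x - (F x / Θ x + G x / Θ x ^ 2)) ^ 2 ∂(Measure.pi ν)
        ≤ ∫ x, (2 * (F x * (Θ x)⁻¹ * (Θ x - 1)) ^ 2 + 2 * H x) ∂(Measure.pi ν) := by
          refine integral_mono_ae hdiff2.integrable_sq
            ((hAi.const_mul 2).add (hHi.const_mul 2)) ?_
          filter_upwards [hdiff, hGH] with x h1 h2
          rw [h1]
          nlinarith [sq_nonneg (F x * (Θ x)⁻¹ * (Θ x - 1) + G x / Θ x ^ 2)]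
      _ = 2 * ∫ x, (F x * (Θ x)⁻¹ * (Θ x - 1)) ^ 2 ∂(Measure.pi ν) +
          2 * ∫ x, H x ∂(Measure.pi ν) := by
          rw [integral_add (hAi.const_mul 2) (hHi.const_mul 2), integral_const_mul,
            integral_const_mul]
      _ ≤ 2 * (3920 * 2600000 * (B ^ 10 * fourthSum a * n ^ 2)) +
          2 * (30000 * B ^ 7 * fourthSum a * n ^ 3) := by
          gcongr
          refine hAle.trans (le_of_eq ?_)
          rw [mul_pow, Real.sq_sqrt (by positivity), Real.sq_sqrt (by positivity)]
          ring
      -- Here `1 ≤ n` raises `n²` to `n³` and `1 ≤ B` raises `B⁷` to `B¹⁰`; `3920` is `1960` times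
      -- the normalized sum `∑ rowSq = 2`.
      _ ≤ 2 * (3920 * 2600000 * (B ^ 10 * fourthSum a * n ^ 3)) +
          2 * (30000 * B ^ 10 * fourthSum a * n ^ 3) := by
          gcongr
          · norm_num
          · norm_num
      _ ≤ 30000000000 * B ^ 10 * fourthSum a * n ^ 3 := by
          have : 0 ≤ B ^ 10 * fourthSum a * n ^ 3 := by positivity
          nlinarith

theorem fisherDistance_quadPart_le {B : ℝ} (h : KernelMoments ν t B)
    {U : ι → Set ℝ} (hU : ∀ u, IsSteinKernel (ν u) (U u) (t u) (dt u))
    (hdt : ∀ u, LpLe (ν u) (8 : ℕ) (dt u) B)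
    (hsymm : ∀ u v, a u v = a v u) (hdiag : ∀ u, a u u = 0) (hsum : ∑ k, rowSq a k = 2) :
    fisherDistance ((Measure.pi ν).map (quadPart a Finset.univ)) ≤
      ENNReal.ofReal (30000000000 * B ^ 10 * fourthSum a) *
        eLpNorm (fun x => ‖thetaPart a t Finset.univ x‖ₑ⁻¹) 8 (Measure.pi ν) ^ 3 := by
  have hΘm := measurable_thetaPart h hsymm hdiag (a := a) Finset.univ
  have hB := h.one_le
  -- Needed when the norm of `Θ⁻¹` is infinite: with a zero prefactor the convention `0 * ∞ = 0`
  -- would make the bound false-looking rather than trivial.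
  have hR : 0 < fourthSum a := by
    refine lt_of_lt_of_le ?_ (sum_rowSq_sq_le a)
    by_contra hneg
    have h0 : ∑ k, rowSq a k ^ 2 = 0 :=
      le_antisymm (not_lt.1 hneg) (Finset.sum_nonneg fun _ _ => sq_nonneg _)
    rw [Finset.sum_eq_zero_iff_of_nonneg fun _ _ => sq_nonneg _] at h0
    have h1 : ∑ k, rowSq a k = 0 :=
      Finset.sum_eq_zero fun k hk => pow_eq_zero_iff two_ne_zero |>.1 (h0 k hk)
    rw [h1] at hsum
    norm_num at hsum
  set N := eLpNorm (fun x => ‖thetaPart a t Finset.univ x‖ₑ⁻¹) 8 (Measure.pi ν) with hN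
  by_cases htop : N = ∞
  · rw [htop, ENNReal.top_pow (by norm_num), ENNReal.mul_top]
    · exact le_top
    · exact (ENNReal.ofReal_pos.2 (by positivity)).ne'
  have hNeq : N ^ 8 = ∫⁻ x, (‖thetaPart a t Finset.univ x‖ₑ⁻¹) ^ 8 ∂(Measure.pi ν) := by
    have := eLpNorm_nnreal_pow_eq_lintegral (f := fun x => ‖thetaPart a t Finset.univ x‖ₑ⁻¹)
      (μ := Measure.pi ν) (p := 8) (by norm_num)
    simpa using this
  have hpos : ∀ᵐ x ∂(Measure.pi ν), 0 < thetaPart a t Finset.univ x := by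
    have hfin : ∫⁻ x, (‖thetaPart a t Finset.univ x‖ₑ⁻¹) ^ 8 ∂(Measure.pi ν) ≠ ∞ := by
      rw [← hNeq]
      exact ENNReal.pow_ne_top htop
    filter_upwards [ae_lt_top (by fun_prop) hfin] with x hx
    refine lt_of_le_of_ne (thetaPart_nonneg hU x) fun h0 => ?_
    rw [← h0] at hx
    simp at hx
  have hn : LpLe (Measure.pi ν) (8 : ℕ) (fun x => (thetaPart a t Finset.univ x)⁻¹) N.toReal := by
    refine LpLe.of_lintegral_le (by norm_num) hΘm.inv ENNReal.toReal_nonneg ?_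
    rw [ENNReal.ofReal_pow ENNReal.toReal_nonneg, ENNReal.ofReal_toReal htop, hNeq]
    refine le_of_eq (lintegral_congr_ae ?_)
    filter_upwards [hpos] with x hx
    rw [enorm_inv hx.ne']
  refine (fisherDistance_quadPart_le_of_lpLe h hU hdt hsymm hdiag hsum hpos hn).trans ?_
  rw [ENNReal.ofReal_mul (by positivity), ENNReal.ofReal_pow ENNReal.toReal_nonneg,
    ENNReal.ofReal_toReal htop]

end Core

/-! ### Transfer to random variables -/

section Transfer

theorem sum_le_eq_half_sum {n : ℕ} {f : Fin n → Fin n → ℝ} (hsymm : ∀ u v, f u v = f v u)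
    (hdiag : ∀ u, f u u = 0) :
    ∑ u, ∑ v ∈ Finset.univ.filter (fun v => u ≤ v), f u v = 1 / 2 * ∑ u, ∑ v, f u v := by
  have h1 : ∑ u, ∑ v ∈ Finset.univ.filter (fun v => ¬ u ≤ v), f u v =
      ∑ u, ∑ v ∈ Finset.univ.filter (fun v => u ≤ v), f u v := by
    simp only [Finset.sum_filter]
    rw [Finset.sum_comm]
    refine Finset.sum_congr rfl fun u _ => Finset.sum_congr rfl fun v _ => ?_
    rcases lt_trichotomy u v with h | rfl | h
    · simp [h, h.le, hsymm u v]
    · simp [hdiag]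
    · simp [h.le, not_le.2 h]
  have h2 : ∑ u, ∑ v, f u v = ∑ u, ∑ v ∈ Finset.univ.filter (fun v => u ≤ v), f u v +
      ∑ u, ∑ v ∈ Finset.univ.filter (fun v => ¬ u ≤ v), f u v := by
    rw [← Finset.sum_add_distrib]
    exact Finset.sum_congr rfl fun u _ =>
      (Finset.sum_filter_add_sum_filter_not Finset.univ (fun v => u ≤ v) _).symm
  rw [h2, h1]
  ring

theorem quadForm_eq_quadPart {n : ℕ} {a : Fin n → Fin n → ℝ}
    (hsymm : ∀ u v, a u v = a v u) (hdiag : ∀ u, a u u = 0) :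
    quadForm (Matrix.of a) = quadPart a Finset.univ := by
  funext x
  simp only [quadForm, quadPart, Matrix.of_apply]
  rw [sum_le_eq_half_sum (f := fun u v => a u v * x u * x v)
    (fun u v => by rw [hsymm u v]; ring) (fun u => by rw [hdiag]; ring), Finset.mul_sum]
  refine Finset.sum_congr rfl fun u _ => ?_
  rw [linPart, Finset.mul_sum, Finset.mul_sum]
  exact Finset.sum_congr rfl fun v _ => by ring

/-- The zero diagonal makes the decomposition linear in `x k`, so the operator acts on a multiple of
the identity and returns that multiple of the Stein kernel. -/
theorem steinOp_quadDecomp {n : ℕ} {a : Fin n → Fin n → ℝ} (hdiag : ∀ u, a u u = 0)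
    (p : Fin n → ℝ → ℝ) (k : Fin n) (x : Fin n → ℝ) :
    steinOp p k (quadDecomp (Matrix.of a) k) x =
      1 / 2 * linPart a Finset.univ k x * steinKernel (p k) (x k) := by
  have h1 : ∀ y, quadDecomp (Matrix.of a) k (Function.update x k y) =
      (1 / 2 * linPart a Finset.univ k x) * y := by
    intro y
    have := freeOf_linPart_self hdiag Finset.univ k x y
    rw [quadDecomp, Function.update_self]
    change 1 / 2 * y * linPart a Finset.univ k (Function.update x k y) = _
    rw [this]
    ring
  rw [steinOp, steinKernel, ← mul_div_assoc]
  congr 1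
  simp only [h1, mul_assoc, integral_const_mul, ← mul_sub]

theorem theta_eq_thetaPart {n : ℕ} {a : Fin n → Fin n → ℝ}
    (hsymm : ∀ u v, a u v = a v u) (hdiag : ∀ u, a u u = 0) {p t : Fin n → ℝ → ℝ}
    {x : Fin n → ℝ} (hx : ∀ u, t u (x u) = steinKernel (p u) (x u)) :
    theta p (quadForm (Matrix.of a)) (quadDecomp (Matrix.of a)) x = thetaPart a t Finset.univ x := by
  rw [theta, thetaPart_univ, Finset.mul_sum]
  refine Finset.sum_congr rfl fun k _ => ?_
  rw [quadForm_eq_quadPart hsymm hdiag, (hasDerivAt_quadPart hsymm hdiag k x (x k)).deriv,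
    steinOp_quadDecomp hdiag, hx]
  ring

/-! ### Homogeneity in the coefficients. -/

section Scaling

variable {ι : Type*} [Fintype ι] [DecidableEq ι] (a : ι → ι → ℝ) (c : ℝ)

theorem linPart_scale (S : Finset ι) (k : ι) (x : ι → ℝ) :
    linPart (fun u v => c * a u v) S k x = c * linPart a S k x := by
  simp only [linPart, Finset.mul_sum, mul_assoc]

theorem quadPart_scale (S : Finset ι) (x : ι → ℝ) :
    quadPart (fun u v => c * a u v) S x = c * quadPart a S x := by
  simp only [quadPart, linPart_scale, Finset.mul_sum]
  exact Finset.sum_congr rfl fun _ _ => by ring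

theorem thetaPart_scale (t : ι → ℝ → ℝ) (x : ι → ℝ) :
    thetaPart (fun u v => c * a u v) t Finset.univ x =
      c ^ 2 * thetaPart a t Finset.univ x := by
  simp only [thetaPart_univ, linPart_scale, Finset.mul_sum]
  exact Finset.sum_congr rfl fun _ _ => by ring

theorem rowSq_scale (k : ι) : rowSq (fun u v => c * a u v) k = c ^ 2 * rowSq a k := by
  simp only [rowSq, mul_pow, Finset.mul_sum]

theorem fourthSum_scale : fourthSum (fun u v => c * a u v) = c ^ 4 * fourthSum a := by
  have h1 : ∀ u v, ∑ k, c * a k u * (c * a k v) = c ^ 2 * ∑ k, a k u * a k v := fun u v => by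
    rw [Finset.mul_sum]
    exact Finset.sum_congr rfl fun _ _ => by ring
  simp only [fourthSum, h1, mul_pow, ← Finset.mul_sum]
  ring

end Scaling

/-- An eighth moment at most `β` gives norm at most `β + 1` because `β ≤ (β + 1)⁸`; this choice also
provides a bound at least `1`. -/
theorem LpLe.map_of_lintegral_le {Ω : Type*} [MeasurableSpace Ω] {P : Measure Ω} {X : Ω → ℝ}
    (hX : Measurable X) {f : ℝ → ℝ} (hf : Measurable f) {β : ℝ≥0}
    (h : ∫⁻ ω, ‖f (X ω)‖ₑ ^ 8 ∂P ≤ β) : LpLe (P.map X) (8 : ℕ) f (β + 1) := by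
  refine LpLe.of_lintegral_le (by norm_num) hf (by positivity) ?_
  rw [lintegral_map (by fun_prop) hX]
  refine h.trans ?_
  rw [← ENNReal.ofReal_coe_nnreal]
  refine ENNReal.ofReal_le_ofReal ?_
  have h1 : (1 : ℝ) ≤ (β : ℝ) + 1 := by linarith [β.coe_nonneg]
  calc (β : ℝ) ≤ (β : ℝ) + 1 := by linarith
    _ = ((β : ℝ) + 1) ^ 1 := (pow_one _).symm
    _ ≤ ((β : ℝ) + 1) ^ 8 := pow_le_pow_right₀ h1 (by norm_num)

variable {Ω : Type*} [MeasurableSpace Ω] {P : Measure Ω} [IsProbabilityMeasure P]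

/-- Nonnegative versions of the Stein kernels of a sequence satisfying the moment bound. -/
theorem exists_kernels {X : ℕ → Ω → ℝ} {p : ℕ → ℝ → ℝ} (hX : ∀ k, Measurable (X k))
    (hmean : ∀ k, ∫ ω, X k ω ∂P = 0) (hvar : ∀ k, variance (X k) P = 1)
    (hp : ∀ k, IsDiffDensity (P.map (X k)) (p k)) {β : ℝ≥0} (hβ : momentBound P X p = β) :
    ∃ (U : ℕ → Set ℝ) (t : ℕ → ℝ → ℝ),
      (∀ k, IsSteinKernel (P.map (X k)) (U k) (t k) (deriv (steinKernel (p k)))) ∧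
      (∀ k, LpLe (P.map (X k)) (8 : ℕ) (deriv (steinKernel (p k))) (β + 1)) ∧
      (∀ n : ℕ, KernelMoments (fun u : Fin n => P.map (X u)) (fun u : Fin n => t u) (β + 1)) ∧
      ∀ᵐ ω ∂P, ∀ k, t k (X k ω) = steinKernel (p k) (X k ω) := by
  have hprob : ∀ k, IsProbabilityMeasure (P.map (X k)) := fun k =>
    Measure.isProbabilityMeasure_map (hX k).aemeasurable
  have hb1 : ∀ k, ∫⁻ ω, ‖X k ω‖ₑ ^ 8 ∂P ≤ β := fun k => by
    rw [← hβ]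
    exact (le_iSup (fun k => ∫⁻ ω, ‖X k ω‖ₑ ^ 8 ∂P) k).trans (le_max_left _ _)
  have hb2 : ∀ k, ∫⁻ ω, ‖steinKernel (p k) (X k ω)‖ₑ ^ 8 ∂P ≤ β := fun k => by
    rw [← hβ]
    exact (le_iSup (fun k => ∫⁻ ω, ‖steinKernel (p k) (X k ω)‖ₑ ^ 8 ∂P) k).trans
      ((le_max_left _ _).trans (le_max_right _ _))
  have hb3 : ∀ k, ∫⁻ ω, ‖deriv (steinKernel (p k)) (X k ω)‖ₑ ^ 8 ∂P ≤ β := fun k => by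
    rw [← hβ]
    exact (le_iSup (fun k => ∫⁻ ω, ‖deriv (steinKernel (p k)) (X k ω)‖ₑ ^ 8 ∂P) k).trans
      ((le_max_right _ _).trans (le_max_right _ _))
  have hid : ∀ k, LpLe (P.map (X k)) (8 : ℕ) (fun y => y) (β + 1) := fun k =>
    LpLe.map_of_lintegral_le (hX k) measurable_id (hb1 k)
  have hm0 : ∀ k, ∫ y, y ∂(P.map (X k)) = 0 := fun k => by
    rw [integral_map (hX k).aemeasurable (by fun_prop), hmean k]
  have hsqi : ∀ k, Integrable (fun y => y ^ 2) (P.map (X k)) := fun k =>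
    ((hid k).memLp.mono_exponent (q := 8) (p := 2) (by norm_num)).integrable_sq
  have hsq : ∀ k, ∫ y, y ^ 2 ∂(P.map (X k)) = 1 := fun k => by
    rw [integral_map (hX k).aemeasurable (by fun_prop),
      ← variance_of_integral_eq_zero (hX k).aemeasurable (hmean k), hvar k]
  choose U t hU heq using fun k => (hp k).exists_isSteinKernel
    ((hid k).memLp.integrable (by norm_num)) (hm0 k)
  have hae : ∀ k, ∀ᵐ ω ∂P, t k (X k ω) = steinKernel (p k) (X k ω) := fun k => by
    filter_upwards [ae_of_ae_map (hX k).aemeasurable (hU k).ae_mem] with ω hω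
    exact heq k _ hω
  have ht : ∀ k, LpLe (P.map (X k)) (8 : ℕ) (t k) (β + 1) := fun k => by
    refine LpLe.map_of_lintegral_le (hX k) (hU k).measurable (le_trans (le_of_eq ?_) (hb2 k))
    refine lintegral_congr_ae ?_
    filter_upwards [hae k] with ω hω
    rw [hω]
  refine ⟨U, t, hU, fun k => LpLe.map_of_lintegral_le (hX k) (measurable_deriv _) (hb3 k),
    fun n => ⟨by linarith [β.coe_nonneg], fun u => hid u, fun u => ht u, fun u => hm0 u,
      fun u => hsq u, fun u => ?_⟩, ae_all_iff.2 hae⟩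
  exact (hU u).integral_eq_one ((ht u).memLp.integrable (by norm_num)) (hsqi u) (hsq u)

/-- The normalized bound is applied to the matrix `σ⁻¹ a`: the functional `fourthSum` scales by
`σ⁻⁴`, `Θ` by `σ⁻²`, and `σ² = ½ ∑ rowSq` turns into the normalization required there. -/
theorem fisherDistance_quadForm_le {X : ℕ → Ω → ℝ} {p : ℕ → ℝ → ℝ} (hX : ∀ k, Measurable (X k))
    (hind : iIndepFun X P) (hmean : ∀ k, ∫ ω, X k ω ∂P = 0) (hvar : ∀ k, variance (X k) P = 1)
    (hp : ∀ k, IsDiffDensity (P.map (X k)) (p k)) {β : ℝ≥0} (hβ : momentBound P X p = β)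
    {n : ℕ} {a : Fin n → Fin n → ℝ} (hsymm : ∀ u v, a u v = a v u)
    (hdiag : ∀ u, a u u = 0) {σ : ℝ}
    (hσ : σ = √(variance (fun ω => quadForm (Matrix.of a) (fun u : Fin n => X u ω)) P)) (hσ0 : 0 < σ) :
    fisherDistance (P.map (fun ω => σ⁻¹ * quadForm (Matrix.of a) (fun u : Fin n => X u ω))) ≤
      ENNReal.ofReal (30000000000 * ((β : ℝ) + 1) ^ 10 / σ ^ 4 * fourthSum a) *
        eLpNorm (fun ω => ENNReal.ofReal (σ ^ 2) * ‖theta (fun u : Fin n => p u) (quadForm (Matrix.of a))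
            (quadDecomp (Matrix.of a)) (fun u : Fin n => X u ω)‖ₑ⁻¹) 8 P ^ 3 := by
  obtain ⟨U, t, hU, hdt, hmom, hae⟩ := exists_kernels hX hmean hvar hp hβ
  have hprob : ∀ k, IsProbabilityMeasure (P.map (X k)) := fun k =>
    Measure.isProbabilityMeasure_map (hX k).aemeasurable
  set ν : Fin n → Measure ℝ := fun u => P.map (X u) with hν
  set Xv : Ω → Fin n → ℝ := fun ω u => X u ω with hXv
  have hXvm : Measurable Xv := measurable_pi_lambda _ fun u => hX u
  have hlaw : P.map Xv = Measure.pi ν := by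
    have h1 : iIndepFun (fun u : Fin n => X u) P := hind.precomp (g := fun u : Fin n => (u : ℕ))
      Fin.val_injective
    exact (iIndepFun_iff_map_fun_eq_pi_map (f := fun u : Fin n => X u)
      fun u => (hX u).aemeasurable).1 h1
  have hmom' : KernelMoments ν (fun u : Fin n => t u) ((β : ℝ) + 1) := hmom n
  have hq := hmom'.integral_quadPart hsymm hdiag (a := a)
  have hqm : Measurable (quadPart a Finset.univ) := measurable_quadPart hmom' hsymm hdiag _
  rw [quadForm_eq_quadPart hsymm hdiag] at hσ ⊢
  have hvarF : variance (fun ω => quadPart a Finset.univ (Xv ω)) P = 1 / 2 * ∑ k, rowSq a k := by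
    have hmean0 : ∫ ω, quadPart a Finset.univ (Xv ω) ∂P = 0 := by
      rw [← hq.1, ← hlaw, integral_map hXvm.aemeasurable hqm.aestronglyMeasurable]
    have hqX : Measurable (fun ω => quadPart a Finset.univ (Xv ω)) := hqm.comp hXvm
    rw [variance_of_integral_eq_zero hqX.aemeasurable hmean0, ← hq.2, ← hlaw,
      integral_map hXvm.aemeasurable (by fun_prop)]
  have hσ2 : σ ^ 2 = 1 / 2 * ∑ k, rowSq a k := by
    rw [hσ, Real.sq_sqrt (variance_nonneg _ _)]
    exact hvarF
  have hσne : σ ≠ 0 := hσ0.ne'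
  have hsum : ∑ k, rowSq (fun u v => σ⁻¹ * a u v) k = 2 := by
    simp only [rowSq_scale, ← Finset.mul_sum]
    have : ∑ k, rowSq a k = 2 * σ ^ 2 := by linarith
    rw [this]
    field_simp
  have core := fisherDistance_quadPart_le hmom' (fun u => hU u) (fun u => hdt u)
    (a := fun u v => σ⁻¹ * a u v) (fun u v => by rw [hsymm u v])
    (fun u => by rw [hdiag, mul_zero]) hsum
  have hθm : Measurable (thetaPart (fun u v => σ⁻¹ * a u v) (fun u : Fin n => t u) Finset.univ) :=
    measurable_thetaPart hmom' (fun u v => by rw [hsymm u v])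
      (fun u => by rw [hdiag, mul_zero]) _
  have hqm' : Measurable (quadPart (fun u v => σ⁻¹ * a u v) Finset.univ) :=
    measurable_quadPart hmom' (fun u v => by rw [hsymm u v])
      (fun u => by rw [hdiag, mul_zero]) _
  rw [← hlaw, Measure.map_map hqm' hXvm,
    eLpNorm_map_measure (by fun_prop) hXvm.aemeasurable] at core
  have e1 : quadPart (fun u v => σ⁻¹ * a u v) Finset.univ ∘ Xv =
      fun ω => σ⁻¹ * quadPart a Finset.univ (Xv ω) := funext fun ω => quadPart_scale a σ⁻¹ _ _
  have e2 : 30000000000 * ((β : ℝ) + 1) ^ 10 * fourthSum (fun u v => σ⁻¹ * a u v) =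
      30000000000 * ((β : ℝ) + 1) ^ 10 / σ ^ 4 * fourthSum a := by
    rw [fourthSum_scale a σ⁻¹]
    field_simp
  -- Only an almost sure equality, since `t` agrees with the Stein kernel just on the open set that
  -- carries the law.
  have e3 : (fun x => ‖thetaPart (fun u v => σ⁻¹ * a u v) (fun u : Fin n => t u)
      Finset.univ x‖ₑ⁻¹) ∘ Xv =ᵐ[P] fun ω => ENNReal.ofReal (σ ^ 2) *
        ‖theta (fun u : Fin n => p u) (quadPart a Finset.univ) (quadDecomp (Matrix.of a)) (Xv ω)‖ₑ⁻¹ := by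
    filter_upwards [hae] with ω hω
    have h1 := theta_eq_thetaPart hsymm hdiag (p := fun u : Fin n => p u)
      (t := fun u : Fin n => t u) (x := Xv ω) fun u => hω u
    rw [quadForm_eq_quadPart hsymm hdiag] at h1
    have h2 : thetaPart (fun u v => σ⁻¹ * a u v) (fun u : Fin n => t u) Finset.univ (Xv ω) =
        σ⁻¹ ^ 2 * thetaPart a (fun u : Fin n => t u) Finset.univ (Xv ω) := thetaPart_scale a σ⁻¹ _ _
    rw [h1, Function.comp_apply, h2, enorm_mul, ENNReal.mul_inv (Or.inr enorm_ne_top)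
      (Or.inl enorm_ne_top), inv_pow, enorm_inv (by positivity), inv_inv,
      Real.enorm_eq_ofReal (by positivity)]
  rwa [e1, e2, eLpNorm_congr_ae e3] at core

end Transfer

end QuadFisher

theorem theorem4p1 (β : ℝ≥0) :
    ∃ C : ℝ, 0 < C ∧
      ∀ (Ω : Type*) (_ : MeasurableSpace Ω) (P : Measure Ω) (_ : IsProbabilityMeasure P)
        (X : ℕ → Ω → ℝ) (p : ℕ → ℝ → ℝ),
        (∀ k, Measurable (X k)) →
        iIndepFun X P →
        (∀ k, ∫ ω, X k ω ∂P = 0) →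
        (∀ k, variance (X k) P = 1) →
        (∀ k, QuadFisher.IsDiffDensity (P.map (X k)) (p k)) →
        QuadFisher.momentBound P X p = (β : ℝ≥0∞) →
        ∀ (n : ℕ) (A : Matrix (Fin n) (Fin n) ℝ), A.IsSymm → (∀ u, A u u = 0) →
        ∀ (F Θ : Ω → ℝ) (σ : ℝ),
          F = (fun ω => QuadFisher.quadForm A (fun u : Fin n => X u ω)) →
          Θ = (fun ω => QuadFisher.theta (fun u : Fin n => p u) (QuadFisher.quadForm A)
            (QuadFisher.quadDecomp A) (fun u : Fin n => X u ω)) →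
          σ = Real.sqrt (variance F P) →
          0 < σ →
          QuadFisher.fisherDistance (P.map (fun ω => σ⁻¹ * F ω)) ≤
            ENNReal.ofReal (C / σ ^ 4 *
              ((∑ k, (∑ v, A k v ^ 2) ^ 2) + (∑ u, ∑ v, (∑ k, A k u * A k v) ^ 2))) *
            eLpNorm (fun ω => ENNReal.ofReal (σ ^ 2) * ‖Θ ω‖ₑ⁻¹) 8 P ^ 3 := by
  refine ⟨30000000000 * ((β : ℝ) + 1) ^ 10, by positivity, ?_⟩
  intro Ω _ P _ X p hX hind hmean hvar hp hβ n A hsymm hdiag F Θ σ hF hΘ hσ hσ0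
  obtain ⟨a, rfl⟩ : ∃ a, A = Matrix.of a := ⟨fun u v => A u v, rfl⟩
  subst hF hΘ
  exact QuadFisher.fisherDistance_quadForm_le hX hind hmean hvar hp hβ
    (fun u v => hsymm.apply v u) hdiag hσ hσ0
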